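/- Let $K$ be a field of characteristic $0$ (for instance $\mathbb R$ or $\mathbb C$) and let $n\ge 0$ be an integer. Let $\mathcal A_v$ and $\mathcal A_w$ be the algebras of differential polynomials over $K$ in the fields $v_{-1},v_0,\dots,v_{n-1}$ and $w_0,\dots,w_n$ respectively, with total derivative $\partial=\,'=d/dx$. Functionals $F=\int f\,dx$ are classes of differential polynomials $f$ modulo total derivatives, and $\delta F/\delta u=\sum_{k\ge0}(-\partial)^k\,\partial f/\partial u^{(k)}$ for each field $u$. For a formal pseudo-differential operator $A=\sum_i a_i\partial^i$ (coefficients on the left) put $A_{\ge0}=\sum_{i\ge0}a_i\partial^i$, $A_0=a_0$, $\operatorname{res}A=a_{-1}$. Consider the Lax operator of the constrained modified KP hierarchy $$\mathcal L=\partial^n+v_{n-1}\partial^{n-1}+\cdots+v_0+\partial^{-1}v_{-1},\qquad \frac{\delta F}{\delta\mathcal L}=\sum_{i=-1}^{n-1}\partial^{-i-1}\frac{\delta F}{\delta v_i},$$ and, for $X=\delta G/\delta\mathcal L$, $$\mathcal P_2X=(\mathcal LX)_{\ge0}\mathcal L-\mathcal L(X\mathcal L)_{\ge0}-[(\mathcal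 LX)_0,\mathcal L]+\partial^{-1}\operatorname{res}([\mathcal L,X])\,\mathcal L+\big[\mathcal L,\,D^{-1}\operatorname{res}[\mathcal L,X]\big],$$ where $D^{-1}a$ denotes an antiderivative of $a$. The second bracket is $\{F,G\}=\int\operatorname{res}\big(\frac{\delta F}{\delta\mathcal L}\,\mathcal P_2\frac{\delta G}{\delta\mathcal L}\big)dx$. Theorem 1. (a) There is exactly one homomorphism of differential $K$-algebras $\mathcal A_v\to\mathcal A_w$ (the Miura map) under which, applied to coefficients, $\mathcal L$ becomes $$\partial^{-1}(\partial-w_n)(\partial-w_{n-1})\cdots(\partial-w_0).$$ (b) For every functional $G$ of the $v_i$, $\operatorname{res}[\mathcal L,\delta G/\delta\mathcal L]$ is the total derivative of a differential polynomial, so $D^{-1}$ in $\mathcal P_2$ makes sense. (c) The Miura map transforms the second bracket into the constant bracket: for all functionals $F,G$ of the $v_i$, the image of $\{F,G\}$ under the Miura map is $$-\int\sum_{i=0}^n\frac{\delta F}{\delta w_i}\Big(\frac{\delta G}{\delta w_i}\Big)'dx+\int\sum_{i=0}^n\frac{\delta F}{\delta w_i}\sum_{j=0}^n\Big(\frac{\delta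 G}{\delta w_j}\Big)'dx,$$ where on the right $F$ and $G$ are regarded, through the Miura map, as functionals of the $w_i$. -/

import Mathlib

open scoped Differential

namespace MKP

noncomputable section

/-! ### Formal pseudo-differential operators over a commutative differential ring -/

/-- Families `(a i)` of coefficients, indexed by `i : ℤ`, that vanish for all large `i`. -/
def boundedAbove (A : Type*) [CommRing A] : AddSubgroup (ℤ → A) where
  carrier := {a | ∃ N : ℤ, ∀ i, N < i → a i = 0}
  zero_mem' := ⟨0, fun _ _ => rfl⟩
  add_mem' := by
    rintro a b ⟨M, hM⟩ ⟨N, hN⟩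
    refine ⟨max M N, fun i hi => ?_⟩
    simp [hM i (lt_of_le_of_lt (le_max_left _ _) hi),
      hN i (lt_of_le_of_lt (le_max_right _ _) hi)]
  neg_mem' := by
    rintro a ⟨M, hM⟩
    exact ⟨M, fun i hi => by simp [hM i hi]⟩

/-- Formal pseudo-differential operators `∑_{i ≤ N} a_i ∂^i`, with the coefficients written on the
left of the powers of `∂`. -/
def PDO (A : Type*) [CommRing A] : Type _ := boundedAbove A

namespace PDO

section Basic

variable {A : Type*} [CommRing A]

instance : AddCommGroup (PDO A) := inferInstanceAs (AddCommGroup (boundedAbove A))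

/-- The coefficient `a_i` of `∂^i`, the coefficients being written on the left. -/
def coeff (P : PDO A) (i : ℤ) : A := P.1 i

/-- The operator `a ∂^i`. -/
def monomial (i : ℤ) (a : A) : PDO A :=
  ⟨Pi.single i a, i, fun _ hj => Pi.single_eq_of_ne (M := fun _ => A) hj.ne' a⟩

/-- The power `∂^i` of `∂`, for any integer `i`. -/
def D (i : ℤ) : PDO A := monomial i 1

/-- The operator of multiplication by `a`. -/
def ofFun (a : A) : PDO A := monomial 0 a

instance : One (PDO A) := ⟨ofFun 1⟩

/-- The differential part `P_{≥ 0} = ∑_{i ≥ 0} a_i ∂^i`. -/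
def nonneg (P : PDO A) : PDO A :=
  ⟨fun i => if 0 ≤ i then P.coeff i else 0, by
    obtain ⟨N, hN⟩ := P.2
    exact ⟨N, fun i hi => by simp [coeff, hN i hi]⟩⟩

/-- The residue, that is, the coefficient of `∂^{-1}`. -/
def res (P : PDO A) : A := P.coeff (-1)

/-- A ring homomorphism applied to all the coefficients. -/
def map {B : Type*} [CommRing B] (φ : A →+* B) (P : PDO A) : PDO B :=
  ⟨fun i => φ (P.coeff i), by
    obtain ⟨N, hN⟩ := P.2
    exact ⟨N, fun i hi => by simp [coeff, hN i hi]⟩⟩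

end Basic

section Composition

variable {A : Type*} [CommRing A] [Differential A]

/-- Composition, determined by `∂^i b = ∑_{k ≥ 0} (i choose k) b^{(k)} ∂^{i - k}` for all `i : ℤ`:
the coefficient of `∂^m` in `P Q` is `∑ (i choose k) p_i (q_j)^{(k)}` over all `k ≥ 0` and all
integers `i, j` with `i + j - k = m`. Only finitely many terms of this sum are nonzero. -/
instance : Mul (PDO A) where
  mul P Q :=
    ⟨fun m => ∑ᶠ p : ℕ × ℤ,
        Ring.choose p.2 p.1 •
          (P.coeff p.2 * (fun a : A => a′)^[p.1] (Q.coeff (m - p.2 + p.1))), by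
      obtain ⟨M, hM⟩ := P.2
      obtain ⟨N, hN⟩ := Q.2
      refine ⟨M + N, fun m hm => ?_⟩
      refine finsum_eq_zero_of_forall_eq_zero ?_
      rintro ⟨k, i⟩
      rcases lt_or_ge M i with h | h
      · simp [coeff, hM i h]
      · have h0 : ∀ k : ℕ, (fun a : A => a′)^[k] 0 = 0 := fun k => by
          induction k with
          | zero => rfl
          | succ k ih => rw [Function.iterate_succ_apply', ih]; simp
        have : Q.coeff (m - i + k) = 0 := hN _ (by omega)
        simp [this, h0]⟩

/-- The finiteness claimed for the sum that defines the composition. -/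
theorem finite_support_mul (P Q : PDO A) (m : ℤ) :
    (Function.support fun p : ℕ × ℤ => Ring.choose p.2 p.1 •
      (P.coeff p.2 * (fun a : A => a′)^[p.1] (Q.coeff (m - p.2 + p.1)))).Finite := by
  obtain ⟨M, hM⟩ := P.2
  obtain ⟨N, hN⟩ := Q.2
  have h0 : ∀ k : ℕ, (fun a : A => a′)^[k] 0 = 0 := fun k => by
    induction k with
    | zero => rfl
    | succ k ih => rw [Function.iterate_succ_apply', ih]; simp
  refine ((Set.finite_Iic (N + M - m).toNat).prod (Set.finite_Icc (m - N) M)).subset ?_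
  rintro ⟨k, i⟩ h
  have h1 : i ≤ M := by
    by_contra hi
    exact h (by simp [coeff, hM i (not_le.mp hi)])
  have h2 : m - i + k ≤ N := by
    by_contra hi
    have : Q.coeff (m - i + k) = 0 := hN _ (not_le.mp hi)
    exact h (by simp [this, h0])
  simp only [Set.mem_prod, Set.mem_Iic, Set.mem_Icc]
  omega

/-- The commutator `[P, Q] = P Q - Q P`. -/
def comm (P Q : PDO A) : PDO A := P * Q - Q * P

end Composition

end PDO

open Classical in
/-- `D⁻¹ a`: an element whose derivative is `a`, when there is one. -/
def antideriv {A : Type*} [CommRing A] [Differential A] (a : A) : A :=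
  if h : ∃ b : A, b′ = a then h.choose else 0

/-- The second Oevel-Strampp tensor `𝒫₂` at the Lax operator `L`, applied to the gradient `X`. -/
def P2 {A : Type*} [CommRing A] [Differential A] (L X : PDO A) : PDO A :=
  (L * X).nonneg * L - L * (X * L).nonneg - PDO.comm (PDO.ofFun ((L * X).coeff 0)) L
    + PDO.D (-1) * PDO.ofFun (PDO.comm L X).res * L
    + PDO.comm L (PDO.ofFun (antideriv (PDO.comm L X).res))

/-! ### Differential polynomials, functionals and variational derivatives -/

/-- Differential polynomials over `K` in the fields `u_i`, `i : ι`: polynomials in the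
jet variables `X (i, k) = u_i^{(k)}`. -/
abbrev DiffPoly (K ι : Type*) [Field K] : Type _ := MvPolynomial (ι × ℕ) K

section Variational

variable (K ι : Type*) [Field K]

/-- The total derivative `∂ = d/dx`, for which `∂ u_i^{(k)} = u_i^{(k+1)}`. -/
def totalDeriv : Derivation K (DiffPoly K ι) (DiffPoly K ι) :=
  MvPolynomial.mkDerivation K fun p => MvPolynomial.X (p.1, p.2 + 1)

instance : Differential (DiffPoly K ι) := ⟨(totalDeriv K ι).restrictScalars ℤ⟩

/-- Functionals `∫ f dx`: differential polynomials modulo total derivatives. -/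
abbrev Functional : Type _ :=
  DiffPoly K ι ⧸ LinearMap.range (totalDeriv K ι).toLinearMap

variable {K ι}

/-- The functional `∫ f dx`. -/
def integral : DiffPoly K ι →ₗ[K] Functional K ι := Submodule.mkQ _

/-- The summand `(-∂)^k (∂f / ∂u_i^{(k)})` of the Euler operator. -/
def eulerTerm (i : ι) (k : ℕ) : DiffPoly K ι →ₗ[K] DiffPoly K ι :=
  ((-(totalDeriv K ι).toLinearMap) ^ k) ∘ₗ
    (MvPolynomial.pderiv (i, k) : Derivation K (DiffPoly K ι) (DiffPoly K ι)).toLinearMap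

theorem exists_forall_pderiv_eq_zero (i : ι) (f : DiffPoly K ι) :
    ∃ N : ℕ, ∀ k, N ≤ k → MvPolynomial.pderiv (i, k) f = 0 := by
  classical
  refine ⟨(f.vars.image Prod.snd).sup id + 1, fun k hk => ?_⟩
  refine MvPolynomial.pderiv_eq_zero_of_notMem_vars fun h => ?_
  have : k ≤ (f.vars.image Prod.snd).sup id :=
    Finset.le_sup (f := id) (Finset.mem_image.mpr ⟨(i, k), h, rfl⟩)
  omega

theorem finite_support_eulerTerm (i : ι) (f : DiffPoly K ι) :
    (Function.support fun k => eulerTerm i k f).Finite := by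
  obtain ⟨N, hN⟩ := exists_forall_pderiv_eq_zero i f
  refine (Set.finite_Iio N).subset fun k hk => ?_
  by_contra h
  exact hk (by simp [eulerTerm, hN k (not_lt.mp h)])

/-- The Euler operator `f ↦ ∑_k (-∂)^k (∂f / ∂u_i^{(k)})`. -/
def euler (i : ι) : DiffPoly K ι →ₗ[K] DiffPoly K ι where
  toFun f := ∑ᶠ k, eulerTerm i k f
  map_add' f g := by
    simp only [map_add]
    exact finsum_add_distrib (finite_support_eulerTerm i f) (finite_support_eulerTerm i g)
  map_smul' c f := by
    simp only [map_smul, RingHom.id_apply]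
    exact (smul_finsum c _).symm

theorem pderiv_totalDeriv_zero (i : ι) (f : DiffPoly K ι) :
    MvPolynomial.pderiv (i, 0) (totalDeriv K ι f) =
      totalDeriv K ι (MvPolynomial.pderiv (i, 0) f) := by
  classical
  have h : ⁅(MvPolynomial.pderiv (i, 0) : Derivation K (DiffPoly K ι) (DiffPoly K ι)),
      totalDeriv K ι⁆ = 0 := by
    refine MvPolynomial.derivation_ext fun p => ?_
    rw [Derivation.commutator_apply]
    simp only [totalDeriv, MvPolynomial.mkDerivation_X, MvPolynomial.pderiv_X, Pi.single_apply]
    rw [if_neg (by simp [Prod.ext_iff])]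
    split_ifs <;> simp
  have := DFunLike.congr_fun h f
  rw [Derivation.commutator_apply] at this
  exact sub_eq_zero.mp this

theorem pderiv_totalDeriv_succ (i : ι) (k : ℕ) (f : DiffPoly K ι) :
    MvPolynomial.pderiv (i, k + 1) (totalDeriv K ι f) =
      totalDeriv K ι (MvPolynomial.pderiv (i, k + 1) f) + MvPolynomial.pderiv (i, k) f := by
  classical
  have h : ⁅(MvPolynomial.pderiv (i, k + 1) : Derivation K (DiffPoly K ι) (DiffPoly K ι)),
      totalDeriv K ι⁆ = MvPolynomial.pderiv (i, k) := by
    refine MvPolynomial.derivation_ext fun p => ?_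
    rw [Derivation.commutator_apply]
    simp only [totalDeriv, MvPolynomial.mkDerivation_X, MvPolynomial.pderiv_X, Pi.single_apply,
      Prod.ext_iff, Nat.add_right_cancel_iff]
    split_ifs <;> simp
  have := DFunLike.congr_fun h f
  rw [Derivation.commutator_apply] at this
  exact (sub_eq_iff_eq_add'.mp this)

theorem euler_totalDeriv (i : ι) (f : DiffPoly K ι) : euler i (totalDeriv K ι f) = 0 := by
  obtain ⟨N, hN⟩ := exists_forall_pderiv_eq_zero i f
  have key : ∀ n : ℕ, ∑ k ∈ Finset.range (n + 1), eulerTerm i k (totalDeriv K ι f) =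
      - ((-(totalDeriv K ι).toLinearMap) ^ (n + 1))
        (MvPolynomial.pderiv (i, n) f) := by
    intro n
    induction n with
    | zero => simp [eulerTerm, pderiv_totalDeriv_zero]
    | succ n ih =>
      rw [Finset.sum_range_succ, ih]
      simp only [eulerTerm, LinearMap.comp_apply,
        Derivation.coeFn_coe, pderiv_totalDeriv_succ, map_add]
      rw [pow_succ _ (n + 1)]
      simp
  have hs : (Function.support fun k => eulerTerm i k (totalDeriv K ι f)) ⊆
      Finset.range (N + 1) := by
    intro k hk
    simp only [Finset.coe_range, Set.mem_Iio]
    by_contra h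
    obtain ⟨k, rfl⟩ : ∃ j, k = j + 1 := ⟨k - 1, by omega⟩
    refine hk ?_
    simp [eulerTerm, pderiv_totalDeriv_succ, hN k (by omega), hN (k + 1) (by omega)]
  change ∑ᶠ k, eulerTerm i k (totalDeriv K ι f) = 0
  rw [finsum_eq_sum_of_support_subset _ hs, key, hN N le_rfl]
  simp

/-- The variational derivative `δF/δu_i = ∑_k (-∂)^k (∂f / ∂u_i^{(k)})` of `F = ∫ f dx`. -/
def varDeriv (i : ι) : Functional K ι →ₗ[K] DiffPoly K ι :=
  Submodule.liftQ _ (euler i) (by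
    rintro _ ⟨f, rfl⟩
    exact euler_totalDeriv i f)

end Variational

/-- Homomorphisms of differential `K`-algebras between differential polynomials. -/
structure DiffHom (K ι κ : Type*) [Field K] where
  toAlgHom : DiffPoly K ι →ₐ[K] DiffPoly K κ
  map_totalDeriv' : ∀ f, toAlgHom (totalDeriv K ι f) = totalDeriv K κ (toAlgHom f)

/-- The map `∫ f dx ↦ ∫ φ(f) dx` on functionals, that is, the substitution `φ` of the fields. -/
def DiffHom.onFunctional {K ι κ : Type*} [Field K] (φ : DiffHom K ι κ) :
    Functional K ι →ₗ[K] Functional K κ :=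
  Submodule.mapQ _ _ φ.toAlgHom.toLinearMap (by
    rintro _ ⟨f, rfl⟩
    exact ⟨φ.toAlgHom f, (φ.map_totalDeriv' f).symm⟩)

/-! ### The constrained modified KP hierarchy -/

section CMKP

variable (K : Type*) [Field K] (n : ℕ)

/-- The fields `v_{-1}, v_0, …, v_{n-1}` of the Lax operator are indexed by `Fin (n + 1)` with a
shift by one: `v j` is `v_{j-1}`. -/
def v (j : Fin (n + 1)) : DiffPoly K (Fin (n + 1)) := MvPolynomial.X (j, 0)

/-- The fields `w_0, …, w_n` of the factorization. -/
def w (j : Fin (n + 1)) : DiffPoly K (Fin (n + 1)) := MvPolynomial.X (j, 0)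

/-- The Lax operator `∂^n + v_{n-1} ∂^{n-1} + ⋯ + v_0 + ∂^{-1} v_{-1}`. -/
def lax : PDO (DiffPoly K (Fin (n + 1))) :=
  PDO.D n + ∑ i : Fin n, PDO.ofFun (v K n i.succ) * PDO.D (i : ℤ)
    + PDO.D (-1) * PDO.ofFun (v K n 0)

/-- The factorized operator `∂^{-1} (∂ - w_n) (∂ - w_{n-1}) ⋯ (∂ - w_0)`. -/
def factorizedLax : PDO (DiffPoly K (Fin (n + 1))) :=
  PDO.D (-1) * (List.ofFn fun i : Fin (n + 1) => PDO.D 1 - PDO.ofFun (w K n i.rev)).prod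

variable {K n}

/-- The gradient `δF/δ𝓛 = ∑_{i=-1}^{n-1} ∂^{-i-1} δF/δv_i`. -/
def grad (F : Functional K (Fin (n + 1))) : PDO (DiffPoly K (Fin (n + 1))) :=
  ∑ j : Fin (n + 1), PDO.D (-(j : ℤ)) * PDO.ofFun (varDeriv j F)

/-- The second bracket `{F, G} = ∫ res (δF/δ𝓛 · 𝒫₂ (δG/δ𝓛)) dx`. -/
def bracketP2 (F G : Functional K (Fin (n + 1))) : Functional K (Fin (n + 1)) :=
  integral (grad F * P2 (lax K n) (grad G)).res

/-- The bracket `-∫ ∑ᵢ δF/δwᵢ (δG/δwᵢ)′ dx + ∫ ∑ᵢ δF/δwᵢ ∑ⱼ (δG/δwⱼ)′ dx`. -/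
def bracketW (F G : Functional K (Fin (n + 1))) : Functional K (Fin (n + 1)) :=
  -integral (∑ i, varDeriv i F * (varDeriv i G)′)
    + integral ((∑ i, varDeriv i F) * ∑ j, (varDeriv j G)′)

/-- The substitution `v ↦ v(w)` defined by `𝓛 = ∂^{-1} (∂ - w_n) ⋯ (∂ - w_0)`. -/
def IsMiura (φ : DiffHom K (Fin (n + 1)) (Fin (n + 1))) : Prop :=
  (lax K n).map (φ.toAlgHom : DiffPoly K (Fin (n + 1)) →+* DiffPoly K (Fin (n + 1)))
    = factorizedLax K n

end CMKP

end

end MKP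

/-! Write `L = ∂⁻¹M` with `M = (∂ - w_n) ⋯ (∂ - w_0)`, and put `Q = X∂⁻¹` for a gradient `X`.
Truncation does not commute with conjugation by `∂`, and the extra terms of `𝒫₂` absorb the
discrepancy: `P2_factorized` gives `𝒫₂X = ∂⁻¹(A_M(Q) + [M, s])`, where `A_M(Q) = (MQ)_{≥0}M -
M(QM)_{≥0}` is the Adler map, `s = (LX)_0 + D⁻¹ res[L, X]`, and `s′ = res[M, Q]`.

For one factor `l = ∂ - w`, the Adler map is multiplication by `-(res P)′`, and `res[l, P] = (res
P)′`. Put `g_i = -res(ℓ_i Q U_{i+1})`, where `ℓ_i` is the product of the factors to the right of `∂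
- w_i` and `U_{i+1}` the product of those to its left. Telescoping over the factors gives `A_M(Q) =
∑ U_{i+1} g_i′ ℓ_i` and `res[M, Q] = -∑ g_i′` (`adler_lowerProd`, `res_comm_lowerProd`).

Modulo total derivatives the residue is a trace (`map_res_mul_comm`). Pairing the Adler term with
the gradient of `F` therefore produces `-∫ ∑ g_i(F) g_i(G)′`, and one integration by parts turns the
`[M, s]` term into `∫ ∑ g_i(F) ∑ g_j(G)′` (`map_res_mul_P2`).

It remains to identify `g_i` with `δ/δw_i`. Varying the factorization gives `δM = -∑ U_{i+1} δw_i
ℓ_i`, so both families represent the first variation of the functional. They are compared only under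
the integral against arbitrary test functions (`integral_sum_varDeriv`); skew-symmetry of the
constant bracket lets this replace both arguments.

The trace property is also what makes `res[L, X]` a total derivative. The Miura map exists and is
unique because `∂⁻¹M` has the shape of `L`, whose coefficients can be read off (`exists_laxOf_eq`,
`laxOf_injective`). -/

namespace MKP

noncomputable section

namespace PDO

/-! ### The ring of formal pseudo-differential operators. -/

section IteratedDerivative

variable {A : Type*} [CommRing A] [Differential A]

/-- The iterated derivative `a ↦ a^{(k)}`. -/
def iterDeriv (k : ℕ) : A →+ A where
  toFun := (fun a : A => a′)^[k]
  map_zero' := by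
    induction k with
    | zero => rfl
    | succ k ih => rw [Function.iterate_succ_apply', ih]; simp
  map_add' := by
    induction k with
    | zero => intro a b; rfl
    | succ k ih => intro a b; simp only [Function.iterate_succ_apply']; rw [ih]; simp

@[simp] theorem iterDeriv_zero (a : A) : iterDeriv 0 a = a := rfl

@[simp] theorem iterDeriv_one_apply (a : A) : iterDeriv 1 a = a′ := rfl

theorem iterDeriv_succ (k : ℕ) (a : A) : iterDeriv (k + 1) a = (iterDeriv k a)′ :=
  Function.iterate_succ_apply' _ _ _

theorem iterDeriv_add (k l : ℕ) (a : A) : iterDeriv (k + l) a = iterDeriv k (iterDeriv l a) :=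
  Function.iterate_add_apply _ _ _ _

theorem iterDeriv_of_deriv_eq_zero {a : A} (ha : a′ = 0) {k : ℕ} (hk : k ≠ 0) :
    iterDeriv k a = 0 := by
  obtain ⟨k, rfl⟩ := Nat.exists_eq_succ_of_ne_zero hk
  rw [Nat.succ_eq_add_one, iterDeriv_add, iterDeriv_one_apply, ha, map_zero]

theorem iterDeriv_one {k : ℕ} (hk : k ≠ 0) : iterDeriv k (1 : A) = 0 :=
  iterDeriv_of_deriv_eq_zero (by simp) hk

open Finset in
theorem iterDeriv_mul (k : ℕ) (a b : A) :
    iterDeriv k (a * b) =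
      ∑ p ∈ antidiagonal k, k.choose p.1 • (iterDeriv p.1 a * iterDeriv p.2 b) := by
  induction k with
  | zero => simp
  | succ k ih =>
    rw [sum_antidiagonal_choose_succ_nsmul (fun i j => iterDeriv i a * iterDeriv j b) k]
    simp only [iterDeriv_succ, ih, map_sum, map_nsmul, Derivation.leibniz, smul_eq_mul, nsmul_add,
      sum_add_distrib]
    refine congrArg₂ _ rfl (sum_congr rfl ?_)
    rintro ⟨i, j⟩ hij
    rw [Nat.choose_symm_of_eq_add (Finset.HasAntidiagonal.mem_antidiagonal.1 hij).symm, mul_comm]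

end IteratedDerivative

section Linear

variable {A : Type*} [CommRing A]

@[ext] theorem ext {P Q : PDO A} (h : ∀ i, P.coeff i = Q.coeff i) : P = Q :=
  Subtype.ext (funext h)

/-- The coefficient of `∂^i` as an additive map. -/
def coeffHom (i : ℤ) : PDO A →+ A where
  toFun P := P.coeff i
  map_zero' := rfl
  map_add' _ _ := rfl

@[simp] theorem coeff_zero (i : ℤ) : (0 : PDO A).coeff i = 0 := rfl

@[simp] theorem coeff_add (P Q : PDO A) (i : ℤ) : (P + Q).coeff i = P.coeff i + Q.coeff i := rfl

@[simp] theorem coeff_neg (P : PDO A) (i : ℤ) : (-P).coeff i = -P.coeff i := rfl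

@[simp] theorem coeff_sub (P Q : PDO A) (i : ℤ) : (P - Q).coeff i = P.coeff i - Q.coeff i := by
  rw [sub_eq_add_neg, coeff_add, coeff_neg, sub_eq_add_neg]

@[simp] theorem coeff_sum {σ : Type*} (s : Finset σ) (f : σ → PDO A) (i : ℤ) :
    (∑ j ∈ s, f j).coeff i = ∑ j ∈ s, (f j).coeff i :=
  map_sum (coeffHom i) f s

theorem coeff_monomial (i : ℤ) (a : A) (m : ℤ) :
    (monomial i a).coeff m = if m = i then a else 0 := by
  by_cases h : m = i
  · subst h; simp [coeff, monomial]
  · simp [coeff, monomial, h]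

theorem coeff_nonneg (P : PDO A) (m : ℤ) :
    P.nonneg.coeff m = if 0 ≤ m then P.coeff m else 0 := rfl

/-- `P` has order at most `N`. -/
def OrdLE (P : PDO A) (N : ℤ) : Prop := ∀ i, N < i → P.coeff i = 0

theorem exists_ordLE (P : PDO A) : ∃ N, P.OrdLE N := P.2

theorem OrdLE.mono {P : PDO A} {M N : ℤ} (h : P.OrdLE M) (hMN : M ≤ N) : P.OrdLE N :=
  fun i hi => h i (by omega)

theorem OrdLE.sub {P Q : PDO A} {N : ℤ} (hP : P.OrdLE N) (hQ : Q.OrdLE N) : (P - Q).OrdLE N :=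
  fun i hi => by simp [hP i hi, hQ i hi]

theorem ordLE_monomial (i : ℤ) (a : A) : (monomial i a).OrdLE i :=
  fun m hm => by rw [coeff_monomial, if_neg hm.ne']

/-- Every operator is a finite sum of monomials up to an operator of prescribed order. -/
theorem exists_sub_sum_ordLE (P : PDO A) (S : ℤ) :
    ∃ s : Finset ℤ, (P - ∑ i ∈ s, monomial i (P.coeff i)).OrdLE S := by
  obtain ⟨N, hN⟩ := P.exists_ordLE
  refine ⟨Finset.Ioc S N, fun i hi => ?_⟩
  simp only [coeff_sub, coeff_sum, coeff_monomial, Finset.sum_ite_eq, Finset.mem_Ioc]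
  split_ifs with h
  · simp
  · rw [hN i (by omega), sub_zero]

/-- An additive map that vanishes on monomials and on the operators of sufficiently low order
vanishes. -/
theorem eq_zero_of_monomial {B : Type*} [AddCommGroup B] (f : PDO A →+ B) (S : ℤ)
    (hS : ∀ P : PDO A, P.OrdLE S → f P = 0) (hm : ∀ i a, f (monomial i a) = 0) (P : PDO A) :
    f P = 0 := by
  obtain ⟨s, hs⟩ := P.exists_sub_sum_ordLE S
  have h := hS _ hs
  rw [map_sub, map_sum, Finset.sum_eq_zero fun i _ => hm i _, sub_zero] at h
  exact h

end Linear

theorem one_eq_D {A : Type*} [CommRing A] : (1 : PDO A) = D 0 := rfl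

section Ring

variable {A : Type*} [CommRing A] [Differential A]

theorem coeff_mul (P Q : PDO A) (m : ℤ) :
    (P * Q).coeff m = ∑ᶠ p : ℕ × ℤ, Ring.choose p.2 p.1 •
      (P.coeff p.2 * iterDeriv p.1 (Q.coeff (m - p.2 + p.1))) := rfl

theorem finite_support_coeff_mul (P Q : PDO A) (m : ℤ) :
    (Function.support fun p : ℕ × ℤ => Ring.choose p.2 p.1 •
      (P.coeff p.2 * iterDeriv p.1 (Q.coeff (m - p.2 + p.1)))).Finite :=
  finite_support_mul P Q m

protected theorem mul_add (P Q R : PDO A) : P * (Q + R) = P * Q + P * R := by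
  ext m
  rw [coeff_add, coeff_mul, coeff_mul, coeff_mul, ← finsum_add_distrib
    (finite_support_coeff_mul P Q m) (finite_support_coeff_mul P R m)]
  simp only [coeff_add, map_add, mul_add, smul_add]

protected theorem add_mul (P Q R : PDO A) : (P + Q) * R = P * R + Q * R := by
  ext m
  rw [coeff_add, coeff_mul, coeff_mul, coeff_mul, ← finsum_add_distrib
    (finite_support_coeff_mul P R m) (finite_support_coeff_mul Q R m)]
  simp only [coeff_add, add_mul, smul_add]

theorem OrdLE.mul {P Q : PDO A} {M N : ℤ} (hP : P.OrdLE M) (hQ : Q.OrdLE N) :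
    (P * Q).OrdLE (M + N) := by
  intro m hm
  rw [coeff_mul]
  refine finsum_eq_zero_of_forall_eq_zero ?_
  rintro ⟨k, i⟩
  rcases lt_or_ge M i with h | h
  · simp [hP i h]
  · have : Q.coeff (m - i + k) = 0 := hQ _ (by omega)
    simp [this]

-- Counting coefficients downwards from the top order turns the `finsum` of the composition into a
-- sum over an antidiagonal, which can be reindexed.
open Finset in
theorem coeff_monomial_mul (i : ℤ) (a : A) {Q : PDO A} {N : ℤ} (hQ : Q.OrdLE N) (s : ℕ) :
    (monomial i a * Q).coeff (i + N - s) = ∑ p ∈ antidiagonal s,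
      Ring.choose i p.1 • (a * iterDeriv p.1 (Q.coeff (N - p.2))) := by
  classical
  have hinj : Set.InjOn (fun p : ℕ × ℕ => (p.1, i)) (antidiagonal s) := by
    rintro ⟨k, r⟩ h ⟨k', r'⟩ h' e
    simp only [mem_coe, Finset.HasAntidiagonal.mem_antidiagonal, Prod.mk.injEq] at h h' e ⊢
    omega
  rw [coeff_mul, finsum_eq_finsetSum_of_support_subset
    (s := (antidiagonal s).image fun p => (p.1, i)), sum_image hinj]
  · refine sum_congr rfl ?_
    rintro ⟨k, r⟩ h
    rw [Finset.HasAntidiagonal.mem_antidiagonal] at h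
    simp only at h ⊢
    rw [coeff_monomial, if_pos rfl, show i + N - (s : ℤ) - i + k = N - r by omega]
  · rintro ⟨k, j⟩ h
    rw [Function.mem_support] at h
    simp only [coe_image, Set.mem_image, mem_coe, Finset.HasAntidiagonal.mem_antidiagonal, Prod.exists, Prod.mk.injEq]
    have hj : j = i := by
      by_contra hj
      exact h (by simp [coeff_monomial, hj])
    subst hj
    have hk : k ≤ s := by
      by_contra hk
      have : Q.coeff (j + N - s - j + k) = 0 := hQ _ (by omega)
      exact h (by simp [this])
    exact ⟨k, s - k, by omega, rfl, rfl⟩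

open Finset in
theorem coeff_mul_monomial {P : PDO A} {N : ℤ} (hP : P.OrdLE N) (j : ℤ) (b : A) (s : ℕ) :
    (P * monomial j b).coeff (N + j - s) = ∑ p ∈ antidiagonal s,
      Ring.choose (N - p.1) p.2 • (P.coeff (N - p.1) * iterDeriv p.2 b) := by
  classical
  have hinj : Set.InjOn (fun p : ℕ × ℕ => (p.2, N - p.1)) (antidiagonal s) := by
    rintro ⟨k, r⟩ h ⟨k', r'⟩ h' e
    simp only [mem_coe, Finset.HasAntidiagonal.mem_antidiagonal, Prod.mk.injEq] at h h' e ⊢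
    omega
  rw [coeff_mul, finsum_eq_finsetSum_of_support_subset
    (s := (antidiagonal s).image fun p => (p.2, N - p.1)), sum_image hinj]
  · refine sum_congr rfl ?_
    rintro ⟨r, k⟩ h
    rw [Finset.HasAntidiagonal.mem_antidiagonal] at h
    simp only at h ⊢
    rw [coeff_monomial, if_pos (by omega)]
  · rintro ⟨k, i⟩ h
    rw [Function.mem_support] at h
    simp only [coe_image, Set.mem_image, mem_coe, Finset.HasAntidiagonal.mem_antidiagonal, Prod.exists, Prod.mk.injEq]
    have h1 : N + j - s - i + k = j := by
      by_contra h1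
      exact h (by rw [coeff_monomial, if_neg h1, map_zero, mul_zero, smul_zero])
    have h2 : i ≤ N := by
      by_contra h2
      exact h (by rw [hP i (by omega), zero_mul, smul_zero])
    exact ⟨(N - i).toNat, k, by omega, rfl, by omega⟩

theorem coeff_monomial_mul_monomial (i j : ℤ) (a b : A) (s : ℕ) :
    (monomial i a * monomial j b).coeff (i + j - s) = Ring.choose i s • (a * iterDeriv s b) := by
  rw [coeff_monomial_mul i a (ordLE_monomial j b), Finset.sum_eq_single (s, 0)]
  · simp [coeff_monomial]
  · rintro ⟨k, r⟩ h hne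
    rw [Finset.HasAntidiagonal.mem_antidiagonal] at h
    have hr : r ≠ 0 := by
      rintro rfl
      exact hne (by simp at h; simp [h])
    simp [coeff_monomial, hr]
  · simp

-- The binomial identity behind associativity: Vandermonde for `(i - p) + j`, followed by `(i choose
-- p)(i - p choose q) = (i choose p + q)(p + q choose p)`.
open Finset in
theorem choose_vandermonde (i j : ℤ) (p t : ℕ) :
    Ring.choose i p * Ring.choose (i + j - p) t = ∑ q ∈ antidiagonal t,
      Ring.choose i (p + q.1) * ((p + q.1).choose p * Ring.choose j q.2) := by
  rw [show i + j - (p : ℤ) = (i - p) + j by ring, Ring.add_choose_eq t (Commute.all _ _), mul_sum]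
  refine sum_congr rfl fun q _ => ?_
  have h := Ring.choose_smul_choose i (Nat.le_add_right p q.1)
  rw [Nat.add_sub_cancel_left, nsmul_eq_mul] at h
  rw [← mul_assoc, ← h]
  ring

open Finset in
theorem monomial_mul_assoc (i j l : ℤ) (a b c : A) :
    monomial i a * monomial j b * monomial l c = monomial i a * (monomial j b * monomial l c) := by
  have h1 := (ordLE_monomial i a).mul (ordLE_monomial j b)
  have h2 := (ordLE_monomial j b).mul (ordLE_monomial l c)
  ext m
  rcases lt_or_ge (i + j + l) m with hm | hm
  · rw [(h1.mul (ordLE_monomial l c)) m hm, ((ordLE_monomial i a).mul h2) m (by omega)]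
  obtain ⟨s, rfl⟩ : ∃ s : ℕ, m = i + j + l - s := ⟨(i + j + l - m).toNat, by omega⟩
  rw [coeff_mul_monomial h1, show i + j + l - (s : ℤ) = i + (j + l) - s by ring,
    coeff_monomial_mul _ _ h2]
  simp only [coeff_monomial_mul_monomial, map_zsmul, iterDeriv_mul, ← iterDeriv_add]
  calc ∑ p ∈ antidiagonal s, Ring.choose (i + j - p.1) p.2 •
        ((Ring.choose i p.1 • (a * iterDeriv p.1 b)) * iterDeriv p.2 c)
      = ∑ p ∈ antidiagonal s, ∑ q ∈ antidiagonal p.2,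
          (Ring.choose i (p.1 + q.1) * ((p.1 + q.1).choose p.1 * Ring.choose j q.2) : ℤ) •
            (a * (iterDeriv p.1 b * iterDeriv p.2 c)) := by
        refine sum_congr rfl fun p _ => ?_
        rw [← sum_smul, ← choose_vandermonde, smul_mul_assoc, smul_smul, mul_comm, mul_assoc]
    _ = ∑ p ∈ antidiagonal s, ∑ q ∈ antidiagonal p.1,
          (Ring.choose i p.1 * (p.1.choose q.1 * Ring.choose j p.2) : ℤ) •
            (a * (iterDeriv q.1 b * iterDeriv (q.2 + p.2) c)) := by
        -- Both sides run over triples of naturals with sum `s`; only the bracketing of the triple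
        -- changes.
        simp only [sum_sigma']
        refine sum_nbij' (fun x => ⟨(x.1.1 + x.2.1, x.2.2), (x.1.1, x.2.1)⟩)
          (fun x => ⟨(x.2.1, x.2.2 + x.1.2), (x.2.2, x.1.2)⟩) ?_ ?_ ?_ ?_ ?_
        · rintro ⟨⟨p, t⟩, ⟨q, r⟩⟩ h
          simp only [mem_sigma, Finset.HasAntidiagonal.mem_antidiagonal] at h ⊢
          exact ⟨by omega, trivial⟩
        · rintro ⟨⟨p, t⟩, ⟨q, r⟩⟩ h
          simp only [mem_sigma, Finset.HasAntidiagonal.mem_antidiagonal] at h ⊢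
          exact ⟨by omega, trivial⟩
        · rintro ⟨⟨p, t⟩, ⟨q, r⟩⟩ h
          simp only [mem_sigma, Finset.HasAntidiagonal.mem_antidiagonal] at h ⊢
          obtain ⟨_, rfl⟩ := h
          rfl
        · rintro ⟨⟨p, t⟩, ⟨q, r⟩⟩ h
          simp only [mem_sigma, Finset.HasAntidiagonal.mem_antidiagonal] at h ⊢
          obtain ⟨_, rfl⟩ := h
          rfl
        · rintro ⟨⟨p, t⟩, ⟨q, r⟩⟩ h
          simp only [mem_sigma, Finset.HasAntidiagonal.mem_antidiagonal] at h ⊢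
          obtain ⟨_, rfl⟩ := h
          rfl
    _ = _ := by
        refine sum_congr rfl fun p _ => ?_
        simp only [mul_sum, smul_sum]
        refine sum_congr rfl fun q _ => ?_
        simp only [← Nat.cast_smul_eq_nsmul ℤ, mul_smul_comm, smul_smul]
        congr 1
        ring

/-- Multiplication on the left, as an additive map. -/
def mulLeft (P : PDO A) : PDO A →+ PDO A := AddMonoidHom.mk' (P * ·) (PDO.mul_add P)

/-- Multiplication on the right, as an additive map. -/
def mulRight (Q : PDO A) : PDO A →+ PDO A := AddMonoidHom.mk' (· * Q) fun P R => PDO.add_mul P R Q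

protected theorem mul_assoc (P Q R : PDO A) : P * Q * R = P * (Q * R) := by
  -- A map shifting orders by a bounded amount has each coefficient insensitive to the low-order
  -- tail of its argument, so monomials suffice. This is applied to the third, second and first
  -- factor in turn.
  have reduce : ∀ f : PDO A →+ PDO A, (∃ c, ∀ N P, OrdLE P N → (f P).OrdLE (N + c)) →
      (∀ i a, f (monomial i a) = 0) → ∀ P, f P = 0 := by
    rintro f ⟨c, hc⟩ hm P
    ext m
    refine eq_zero_of_monomial ((coeffHom m).comp f) (m - 1 - c)
      (fun P hP => hc _ P hP m (by omega)) (fun i a => ?_) P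
    rw [AddMonoidHom.comp_apply, hm, map_zero]
  obtain ⟨N, hN⟩ := Q.exists_ordLE
  have step1 : ∀ i j a b, ∀ R : PDO A,
      monomial i a * monomial j b * R = monomial i a * (monomial j b * R) := by
    intro i j a b R
    refine sub_eq_zero.mp (reduce (mulLeft (monomial i a * monomial j b) -
      (mulLeft (monomial i a)).comp (mulLeft (monomial j b))) ⟨i + j, fun N P hP => ?_⟩
      (fun l c => sub_eq_zero.mpr (monomial_mul_assoc i j l a b c)) R)
    refine OrdLE.sub ?_ ?_
    · exact (((ordLE_monomial i a).mul (ordLE_monomial j b)).mul hP).mono (by omega)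
    · exact ((ordLE_monomial i a).mul ((ordLE_monomial j b).mul hP)).mono (by omega)
  obtain ⟨T, hT⟩ := R.exists_ordLE
  have step2 : ∀ i a, ∀ Q : PDO A, monomial i a * Q * R = monomial i a * (Q * R) := by
    intro i a Q
    refine sub_eq_zero.mp (reduce ((mulRight R).comp (mulLeft (monomial i a)) -
      (mulLeft (monomial i a)).comp (mulRight R)) ⟨i + T, fun N P hP => ?_⟩
      (fun j b => sub_eq_zero.mpr (step1 i j a b R)) Q)
    refine OrdLE.sub ?_ ?_
    · exact (((ordLE_monomial i a).mul hP).mul hT).mono (by omega)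
    · exact ((ordLE_monomial i a).mul (hP.mul hT)).mono (by omega)
  refine sub_eq_zero.mp (reduce ((mulRight R).comp (mulRight Q) - mulRight (Q * R))
    ⟨N + T, fun S P hP => ?_⟩ (fun i a => sub_eq_zero.mpr (step2 i a Q)) P)
  refine OrdLE.sub ?_ ?_
  · exact ((hP.mul hN).mul hT).mono (by omega)
  · exact (hP.mul (hN.mul hT)).mono (by omega)

theorem coeff_ofFun_mul (a : A) (P : PDO A) (m : ℤ) : (ofFun a * P).coeff m = a * P.coeff m := by
  obtain ⟨N, hN⟩ := P.exists_ordLE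
  rcases lt_or_ge N m with hm | hm
  · rw [ofFun, ((ordLE_monomial 0 a).mul hN) m (by omega), hN m hm, mul_zero]
  obtain ⟨s, rfl⟩ : ∃ s : ℕ, m = 0 + N - s := ⟨(N - m).toNat, by omega⟩
  rw [ofFun, coeff_monomial_mul 0 a hN, Finset.sum_eq_single (0, s)]
  · simp
  · rintro ⟨k, r⟩ h hne
    rw [Finset.HasAntidiagonal.mem_antidiagonal] at h
    have hk : k ≠ 0 := by
      rintro rfl
      exact hne (by simp at h; simp [h])
    simp [Ring.choose_zero_pos ℤ (Nat.pos_of_ne_zero hk)]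
  · simp

theorem coeff_mul_D (P : PDO A) (j m : ℤ) : (P * D j).coeff m = P.coeff (m - j) := by
  obtain ⟨N, hN⟩ := P.exists_ordLE
  rcases lt_or_ge (N + j) m with hm | hm
  · rw [D, (hN.mul (ordLE_monomial j 1)) m hm, hN _ (by omega)]
  obtain ⟨s, rfl⟩ : ∃ s : ℕ, m = N + j - s := ⟨(N + j - m).toNat, by omega⟩
  rw [D, coeff_mul_monomial hN, Finset.sum_eq_single (s, 0)]
  · simp only [Ring.choose_zero_right, one_smul, iterDeriv_zero, mul_one]
    congr 1
    ring
  · rintro ⟨r, k⟩ h hne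
    rw [Finset.HasAntidiagonal.mem_antidiagonal] at h
    have hk : k ≠ 0 := by
      rintro rfl
      exact hne (by simp at h; simp [h])
    rw [iterDeriv_one hk, mul_zero, smul_zero]
  · simp

instance : Ring (PDO A) :=
  { (inferInstance : AddCommGroup (PDO A)), (inferInstance : Mul (PDO A)),
    (inferInstance : One (PDO A)) with
    left_distrib := PDO.mul_add
    right_distrib := PDO.add_mul
    zero_mul := fun P => map_zero (mulRight P)
    mul_zero := fun P => map_zero (mulLeft P)
    mul_assoc := PDO.mul_assoc
    one_mul := fun P => by
      ext m
      exact (coeff_ofFun_mul 1 P m).trans (one_mul _)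
    mul_one := fun P => by
      ext m
      rw [one_eq_D, coeff_mul_D, sub_zero] }

theorem coeff_D_one_mul (P : PDO A) (m : ℤ) :
    (D 1 * P).coeff m = P.coeff (m - 1) + (P.coeff m)′ := by
  obtain ⟨N, hN⟩ := P.exists_ordLE
  rcases lt_or_ge (N + 1) m with hm | hm
  · rw [D, ((ordLE_monomial 1 1).mul hN) m (by omega), hN m (by omega), hN (m - 1) (by omega)]
    simp
  obtain ⟨s, rfl⟩ : ∃ s : ℕ, m = 1 + N - s := ⟨(1 + N - m).toNat, by omega⟩
  rw [D, coeff_monomial_mul 1 1 hN]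
  have hc : ∀ k : ℕ, Ring.choose (1 : ℤ) k = Nat.choose 1 k := fun k => by
    exact_mod_cast Ring.choose_natCast (R := ℤ) 1 k
  cases s with
  | zero =>
    have : P.coeff (1 + N - (0 : ℕ)) = 0 := hN _ (by simp)
    rw [this]
    simp
  | succ s =>
    rw [Finset.Nat.sum_antidiagonal_succ]
    rw [Finset.sum_eq_single (0, s)]
    · simp only [hc]
      simp only [Nat.choose_self, Nat.choose_zero_right, Nat.cast_one, one_smul, one_mul,
        iterDeriv_zero, zero_add, iterDeriv_one_apply, Nat.cast_add]
      rw [show 1 + N - ((s : ℤ) + 1) - 1 = N - (s + 1) by ring,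
        show 1 + N - ((s : ℤ) + 1) = N - s by ring]
    · rintro ⟨k, r⟩ h hne
      rw [Finset.HasAntidiagonal.mem_antidiagonal] at h
      have hk : k ≠ 0 := by
        rintro rfl
        exact hne (by simp at h; simp [h])
      simp only [hc]
      rw [Nat.choose_eq_zero_of_lt (by omega)]
      simp
    · simp

end Ring

end PDO

end

end MKP
namespace MKP

noncomputable section

namespace PDO

/-! ### Differential operators, truncation and the residue. -/

section Additive

variable {A : Type*} [CommRing A]

theorem coeff_ofFun (a : A) (m : ℤ) : (ofFun a).coeff m = if m = 0 then a else 0 :=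
  coeff_monomial 0 a m

theorem coeff_D (i m : ℤ) : (D i : PDO A).coeff m = if m = i then 1 else 0 :=
  coeff_monomial i 1 m

@[simp] theorem ofFun_add (a b : A) : ofFun (a + b) = ofFun a + ofFun b := by
  ext m; simp only [coeff_add, coeff_ofFun]; split_ifs <;> simp

@[simp] theorem ofFun_neg (a : A) : ofFun (-a) = -ofFun a := by
  ext m; simp only [coeff_neg, coeff_ofFun]; split_ifs <;> simp

theorem ordLE_ofFun (a : A) : (ofFun a).OrdLE 0 := ordLE_monomial 0 a

theorem ordLE_D (i : ℤ) : (D i : PDO A).OrdLE i := ordLE_monomial i 1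

/-- `P` is a differential operator. -/
def IsDiff (P : PDO A) : Prop := ∀ i < 0, P.coeff i = 0

theorem IsDiff.add {P Q : PDO A} (hP : P.IsDiff) (hQ : Q.IsDiff) : (P + Q).IsDiff :=
  fun i hi => by simp [hP i hi, hQ i hi]

theorem IsDiff.sub {P Q : PDO A} (hP : P.IsDiff) (hQ : Q.IsDiff) : (P - Q).IsDiff :=
  fun i hi => by simp [hP i hi, hQ i hi]

theorem isDiff_monomial {i : ℤ} (hi : 0 ≤ i) (a : A) : (monomial i a).IsDiff :=
  fun m hm => by rw [coeff_monomial, if_neg (by omega)]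

theorem isDiff_nonneg (P : PDO A) : P.nonneg.IsDiff :=
  fun m hm => by rw [coeff_nonneg, if_neg (by omega)]

theorem IsDiff.eq_ofFun {P : PDO A} (hP : P.IsDiff) (h : P.OrdLE 0) : P = ofFun (P.coeff 0) := by
  ext m
  rw [coeff_ofFun]
  rcases lt_trichotomy m 0 with hm | rfl | hm
  · rw [hP m hm, if_neg hm.ne]
  · simp
  · rw [h m hm, if_neg hm.ne']

theorem ordLE_sub_nonneg (P : PDO A) : (P - P.nonneg).OrdLE (-1) := by
  intro m hm
  rw [coeff_sub, coeff_nonneg, if_pos (by omega), sub_self]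

theorem res_sub (P Q : PDO A) : (P - Q).res = P.res - Q.res := coeff_sub P Q _

theorem res_add (P Q : PDO A) : (P + Q).res = P.res + Q.res := rfl

theorem res_sum {σ : Type*} (s : Finset σ) (f : σ → PDO A) :
    (∑ j ∈ s, f j).res = ∑ j ∈ s, (f j).res := coeff_sum s f _

theorem IsDiff.res_eq_zero {P : PDO A} (hP : P.IsDiff) : P.res = 0 := hP _ (by omega)

theorem res_sub_nonneg (P : PDO A) : (P - P.nonneg).res = P.res := by
  rw [res_sub, (isDiff_nonneg P).res_eq_zero, sub_zero]

end Additive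

section Multiplicative

variable {A : Type*} [CommRing A] [Differential A]

theorem D_mul_D (i j : ℤ) : (D i * D j : PDO A) = D (i + j) := by
  ext m
  rw [coeff_mul_D, coeff_D, coeff_D]
  exact if_congr (by omega) rfl rfl

theorem D_neg_one_mul_D_one : (D (-1) * D 1 : PDO A) = 1 := D_mul_D _ _

theorem D_one_mul_D_neg_one : (D 1 * D (-1) : PDO A) = 1 := D_mul_D _ _

theorem D_neg_one_mul_D_one_mul (P : PDO A) : D (-1) * (D 1 * P) = P := by
  rw [← mul_assoc, D_neg_one_mul_D_one, one_mul]

theorem D_one_mul_D_neg_one_mul (P : PDO A) : D 1 * (D (-1) * P) = P := by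
  rw [← mul_assoc, D_one_mul_D_neg_one, one_mul]

theorem ofFun_mul_D (a : A) (i : ℤ) : ofFun a * D i = monomial i a := by
  ext m
  rw [coeff_ofFun_mul, coeff_D, coeff_monomial, mul_ite, mul_zero, mul_one]

theorem D_one_mul_ofFun (a : A) : D 1 * ofFun a = ofFun a * D 1 + ofFun a′ := by
  ext m
  rw [coeff_D_one_mul, coeff_add, coeff_mul_D, coeff_ofFun, coeff_ofFun, coeff_ofFun]
  split_ifs <;> simp

theorem choose_eq_zero_of_lt {i : ℤ} {k : ℕ} (hi : 0 ≤ i) (h : i < k) : Ring.choose i k = 0 := by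
  lift i to ℕ using hi
  have := Ring.choose_natCast (R := ℤ) i k
  rw [this, Nat.choose_eq_zero_of_lt (by omega), Nat.cast_zero]

theorem IsDiff.mul {P Q : PDO A} (hP : P.IsDiff) (hQ : Q.IsDiff) : (P * Q).IsDiff := by
  intro m hm
  rw [coeff_mul]
  refine finsum_eq_zero_of_forall_eq_zero ?_
  rintro ⟨k, i⟩
  rcases lt_or_ge i 0 with hi | hi
  · simp [hP i hi]
  rcases lt_or_ge (m - i + k) 0 with h | h
  · simp [hQ _ h]
  · rw [choose_eq_zero_of_lt hi (by simp only; omega), zero_smul]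

theorem coeff_mul_top {P Q : PDO A} {M N : ℤ} (hP : P.OrdLE M) (hQ : Q.OrdLE N) :
    (P * Q).coeff (M + N) = P.coeff M * Q.coeff N := by
  rw [coeff_mul, finsum_eq_single _ ((0, M) : ℕ × ℤ)]
  · simp
  · rintro ⟨k, i⟩ h
    rcases lt_trichotomy i M with hi | rfl | hi
    · have : Q.coeff (M + N - i + k) = 0 := hQ _ (by omega)
      simp [this]
    · have hk : k ≠ 0 := fun hk => h (by rw [hk])
      have : Q.coeff (i + N - i + k) = 0 := hQ _ (by omega)
      simp only [this, map_zero, mul_zero, smul_zero]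
    · simp [hP i hi]

theorem res_ofFun_mul (a : A) (P : PDO A) : (ofFun a * P).res = a * P.res :=
  coeff_ofFun_mul a P _

/-- No correction terms arise: `∂^i a` is a differential operator for `i ≥ 0` and has order below
`-1` for `i < -1`. -/
theorem res_mul_ofFun (P : PDO A) (a : A) : (P * ofFun a).res = P.res * a := by
  rw [res, coeff_mul, finsum_eq_single _ ((0, -1) : ℕ × ℤ)]
  · simp [coeff_ofFun, res]
  · rintro ⟨k, i⟩ h
    rcases eq_or_ne (-1 - i + k) 0 with hi | hi
    · have hk : k ≠ 0 := by
        rintro rfl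
        exact h (Prod.ext rfl (by simp at hi ⊢; omega))
      rw [choose_eq_zero_of_lt (by simp only; omega) (by simp only; omega), zero_smul]
    · simp only [coeff_ofFun, if_neg hi, map_zero, mul_zero, smul_zero]

/-- Integration by parts, for a map that vanishes on derivatives. -/
theorem map_mul_deriv {B : Type*} [AddCommGroup B] {f : A →+ B} (hf : ∀ a : A, f a′ = 0)
    (a b : A) : f (a * b′) = -f (a′ * b) := by
  have h := hf (a * b)
  rw [Derivation.leibniz, map_add, smul_eq_mul, smul_eq_mul, mul_comm b] at h
  exact eq_neg_of_add_eq_zero_left h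

theorem map_mul_iterDeriv {B : Type*} [AddCommGroup B] {f : A →+ B} (hf : ∀ a : A, f a′ = 0)
    (k : ℕ) (a b : A) : f (a * iterDeriv k b) = Int.negOnePow k • f (iterDeriv k a * b) := by
  induction k generalizing a with
  | zero => simp
  | succ k ih =>
    rw [iterDeriv_succ, map_mul_deriv hf, ih, ← iterDeriv_one_apply, ← iterDeriv_add]
    push_cast
    rw [Int.negOnePow_succ, Units.neg_smul]

/-- Residues of commutators are killed by every map that vanishes on derivatives. -/
theorem map_res_mul_comm {B : Type*} [AddCommGroup B] {f : A →+ B} (hf : ∀ a : A, f a′ = 0)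
    (P Q : PDO A) : f (P * Q).res = f (Q * P).res := by
  have key : ∀ i j (a b : A), f (monomial i a * monomial j b).res =
      f (monomial j b * monomial i a).res := by
    intro i j a b
    rw [res, res]
    rcases lt_or_ge (i + j) (-1) with h | h
    · rw [((ordLE_monomial i a).mul (ordLE_monomial j b)) _ h,
        ((ordLE_monomial j b).mul (ordLE_monomial i a)) _ (by omega)]
    obtain ⟨s, hs⟩ : ∃ s : ℕ, (s : ℤ) = i + j + 1 := ⟨(i + j + 1).toNat, by omega⟩
    have h1 := coeff_monomial_mul_monomial i j a b s
    have h2 := coeff_monomial_mul_monomial j i b a s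
    -- Since `j = s - 1 - i`, the two binomials differ by `(-1)^s`, exactly the sign of `s`
    -- integrations by parts.
    have h3 := Ring.choose_neg (-i) s
    rw [neg_neg, show -i + (s : ℤ) - 1 = j by omega] at h3
    rw [show i + j - (s : ℤ) = -1 by omega] at h1
    rw [show j + i - (s : ℤ) = -1 by omega] at h2
    rw [h1, h2, map_zsmul, map_zsmul, map_mul_iterDeriv hf, mul_comm b, h3,
      Units.smul_def, Units.smul_def, smul_smul, smul_eq_mul, mul_right_comm,
      ← Units.val_mul, Int.units_mul_self, Units.val_one, one_mul]
  have step : ∀ i a (Q : PDO A), f (monomial i a * Q).res = f (Q * monomial i a).res := by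
    intro i a Q
    refine sub_eq_zero.mp (eq_zero_of_monomial
      (f.comp ((coeffHom (-1)).comp (mulLeft (monomial i a) - mulRight (monomial i a)))) (-2 - i)
      (fun Q hQ => ?_) (fun j b => ?_) Q |>.symm.trans ?_ |>.symm)
    · have h := (((ordLE_monomial i a).mul hQ).mono (show i + (-2 - i) ≤ -2 by omega)).sub
        ((hQ.mul (ordLE_monomial i a)).mono (show -2 - i + i ≤ -2 by omega)) (-1) (by omega)
      exact (congrArg f h).trans (map_zero f)
    · change f (monomial i a * monomial j b - monomial j b * monomial i a).res = 0
      rw [res_sub, map_sub, key, sub_self]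
    · change f (monomial i a * Q - Q * monomial i a).res = _
      rw [res_sub, map_sub]
  obtain ⟨N, hN⟩ := Q.exists_ordLE
  have := eq_zero_of_monomial (f.comp ((coeffHom (-1)).comp (mulRight Q - mulLeft Q))) (-2 - N)
    (fun P hP => ?_) (fun j b => ?_) P
  · change f (P * Q - Q * P).res = 0 at this
    rwa [res_sub, map_sub, sub_eq_zero] at this
  · have h := ((hP.mul hN).mono (show -2 - N + N ≤ -2 by omega)).sub
      ((hN.mul hP).mono (show N + (-2 - N) ≤ -2 by omega)) (-1) (by omega)
    exact (congrArg f h).trans (map_zero f)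
  · change f (monomial j b * Q - Q * monomial j b).res = 0
    rw [res_sub, map_sub, step, sub_self]

/-- The negative part of `∂⁻¹ N` for a differential operator `N`. -/
theorem IsDiff.sub_nonneg_D_neg_one_mul {N : PDO A} (hN : N.IsDiff) :
    D (-1) * N - (D (-1) * N).nonneg = D (-1) * ofFun (D (-1) * N).res := by
  set Z := D (-1) * N with hZ
  -- `∂` times the negative part is a differential operator of order at most `0`, hence a function;
  -- its value is the leading coefficient.
  have hd : (D 1 * (Z - Z.nonneg)).IsDiff := by
    rw [mul_sub, hZ, D_one_mul_D_neg_one_mul]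
    exact hN.sub ((isDiff_monomial (by omega) 1).mul (isDiff_nonneg _))
  have h := hd.eq_ofFun ((ordLE_D 1).mul (ordLE_sub_nonneg Z))
  have ht := coeff_mul_top (ordLE_D 1) (ordLE_sub_nonneg Z)
  rw [show (1 : ℤ) + -1 = 0 by ring, coeff_D, if_pos rfl, one_mul] at ht
  rw [ht, show (Z - Z.nonneg).coeff (-1) = Z.res from res_sub_nonneg Z] at h
  rw [← h, D_neg_one_mul_D_one_mul]

/-- The failure of truncation to commute with conjugation by `∂`. With `E = ∂Z`, the two truncations
differ only in the coefficient of `∂^0`. -/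
theorem D_one_mul_nonneg (E : PDO A) :
    D 1 * (D (-1) * E * D 1).nonneg =
      E.nonneg * D 1 + ofFun ((D (-1) * E * D 1).coeff 0)′ := by
  obtain ⟨Z, rfl⟩ : ∃ Z, E = D 1 * Z := ⟨D (-1) * E, (D_one_mul_D_neg_one_mul E).symm⟩
  rw [D_neg_one_mul_D_one_mul]
  ext m
  simp only [coeff_D_one_mul, coeff_add, coeff_mul_D, coeff_nonneg, coeff_ofFun]
  rcases lt_trichotomy m 0 with hm | rfl | hm
  · simp [hm.ne, show ¬ 0 ≤ m by omega, show ¬ 1 ≤ m by omega]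
  · simp
  · simp [hm.ne', hm.le, show 1 ≤ m by omega]

theorem res_D_neg_one_mul_mul_D_one (E : PDO A) :
    (D (-1) * E * D 1).res = E.res - ((D (-1) * E * D 1).coeff 0)′ := by
  obtain ⟨Z, rfl⟩ : ∃ Z, E = D 1 * Z := ⟨D (-1) * E, (D_one_mul_D_neg_one_mul E).symm⟩
  rw [D_neg_one_mul_D_one_mul, res, res, coeff_D_one_mul, coeff_mul_D, coeff_mul_D]
  simp

/-- The residue is linear over functions on both sides, so `w` drops out; commuting with `∂`
differentiates coefficients. -/
theorem res_firstOrder_mul_sub (w : A) (P : PDO A) :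
    ((D 1 - ofFun w) * P).res - (P * (D 1 - ofFun w)).res = P.res′ := by
  have h1 : (D 1 * P).res = P.coeff (-1 - 1) + P.res′ := coeff_D_one_mul P (-1)
  have h2 : (P * D 1).res = P.coeff (-1 - 1) := coeff_mul_D P 1 (-1)
  rw [sub_mul, mul_sub, res_sub, res_sub, res_ofFun_mul, res_mul_ofFun, h1, h2]
  ring

theorem ordLE_firstOrder (w : A) : (D 1 - ofFun w).OrdLE 1 :=
  (ordLE_D 1).sub ((ordLE_ofFun w).mono (by omega))

theorem coeff_one_firstOrder (w : A) : (D 1 - ofFun w).coeff 1 = 1 := by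
  simp [coeff_D, coeff_ofFun]

theorem isDiff_firstOrder (w : A) : (D 1 - ofFun w).IsDiff :=
  (isDiff_monomial (by omega) 1).sub (isDiff_monomial le_rfl w)

/-- The Adler map of a first order factor. -/
theorem nonneg_mul_firstOrder_sub (w : A) (P : PDO A) :
    ((D 1 - ofFun w) * P).nonneg * (D 1 - ofFun w) -
      (D 1 - ofFun w) * (P * (D 1 - ofFun w)).nonneg = -ofFun P.res′ := by
  set l := D 1 - ofFun w with hl
  have hd : ((l * P).nonneg * l - l * (P * l).nonneg).IsDiff :=
    ((isDiff_nonneg _).mul (isDiff_firstOrder w)).sub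
      ((isDiff_firstOrder w).mul (isDiff_nonneg _))
  -- The terms `lPl` cancel, so truncations may be traded for their complements. The first form is a
  -- differential operator, the second has order at most `0`; hence the operator is a function.
  have he : (l * P).nonneg * l - l * (P * l).nonneg =
      l * (P * l - (P * l).nonneg) - (l * P - (l * P).nonneg) * l := by
    noncomm_ring
  have h1 := (ordLE_firstOrder w).mul (ordLE_sub_nonneg (P * l))
  have h2 := (ordLE_sub_nonneg (l * P)).mul (ordLE_firstOrder w)
  have h3 := coeff_mul_top (ordLE_firstOrder w) (ordLE_sub_nonneg (P * l))
  have h4 := coeff_mul_top (ordLE_sub_nonneg (l * P)) (ordLE_firstOrder w)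
  rw [← hl] at h1 h2 h3 h4
  rw [hd.eq_ofFun (by rw [he]; exact h1.sub h2), ← res_firstOrder_mul_sub w P, ← ofFun_neg, he]
  congr 1
  rw [coeff_sub]
  change (l * (P * l - (P * l).nonneg)).coeff (1 + -1) -
    ((l * P - (l * P).nonneg) * l).coeff (-1 + 1) = _
  rw [h3, h4, coeff_one_firstOrder]
  have h5 := res_sub_nonneg (P * l)
  have h6 := res_sub_nonneg (l * P)
  rw [res] at h5 h6
  rw [h5, h6]
  ring

end Multiplicative

/-! ### Functoriality in the coefficients. -/

section Map

variable {A B : Type*} [CommRing A] [CommRing B]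

/-- An additive map applied to all the coefficients. -/
def mapAdd (d : A →+ B) : PDO A →+ PDO B where
  toFun P := ⟨fun i => d (P.coeff i), by
    obtain ⟨N, hN⟩ := P.2
    exact ⟨N, fun i hi => by simp [coeff, hN i hi]⟩⟩
  map_zero' := by ext m; exact map_zero d
  map_add' P Q := by ext m; exact map_add d _ _

theorem coeff_mapAdd (d : A →+ B) (P : PDO A) (m : ℤ) :
    (mapAdd d P).coeff m = d (P.coeff m) := rfl

theorem mapAdd_monomial (d : A →+ B) (i : ℤ) (a : A) :
    mapAdd d (monomial i a) = monomial i (d a) := by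
  ext m
  rw [coeff_mapAdd, coeff_monomial, coeff_monomial]
  split_ifs <;> simp

theorem mapAdd_D {d : A →+ B} (h1 : d 1 = 0) (i : ℤ) : mapAdd d (D i) = 0 := by
  rw [D, mapAdd_monomial, h1]
  ext m
  simp [coeff_monomial]

variable [Differential A] [Differential B]

theorem map_iterDeriv (d : A →+ B) (hd : ∀ a : A, d a′ = (d a)′) (k : ℕ) (a : A) :
    d (iterDeriv k a) = iterDeriv k (d a) := by
  induction k with
  | zero => rfl
  | succ k ih => rw [iterDeriv_succ, iterDeriv_succ, hd, ih]

/-- A homomorphism of differential rings induces a ring homomorphism of operators. -/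
def mapHom (φ : A →+* B) (hφ : ∀ a : A, φ a′ = (φ a)′) : PDO A →+* PDO B where
  __ := mapAdd φ.toAddMonoidHom
  map_one' := by
    ext m
    exact congrArg (·.coeff m) ((mapAdd_monomial φ.toAddMonoidHom 0 1).trans
      (congrArg (monomial 0) (map_one φ)))
  map_mul' P Q := by
    ext m
    change φ ((P * Q).coeff m) = _
    rw [coeff_mul, coeff_mul]
    refine (AddMonoidHom.map_finsum φ.toAddMonoidHom (finite_support_coeff_mul P Q m)).trans ?_
    refine finsum_congr fun p => ?_
    change φ _ = _ • (φ _ * iterDeriv _ (φ _))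
    rw [map_zsmul, map_mul]
    congr 2
    exact map_iterDeriv φ.toAddMonoidHom hφ _ _

theorem mapHom_apply (φ : A →+* B) (hφ : ∀ a : A, φ a′ = (φ a)′) (P : PDO A) :
    mapHom φ hφ P = P.map φ := rfl

/-- A derivation that commutes with `′` induces a derivation of operators. -/
theorem mapAdd_mul (d : A →+ A) (hd : ∀ a : A, d a′ = (d a)′)
    (hl : ∀ a b : A, d (a * b) = d a * b + a * d b) (P Q : PDO A) :
    mapAdd d (P * Q) = mapAdd d P * Q + P * mapAdd d Q := by
  ext m
  rw [coeff_add, coeff_mapAdd, coeff_mul, coeff_mul, coeff_mul, ← finsum_add_distrib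
    (finite_support_coeff_mul _ Q m) (finite_support_coeff_mul P _ m),
    AddMonoidHom.map_finsum d (finite_support_coeff_mul P Q m)]
  refine finsum_congr fun p => ?_
  rw [map_zsmul, hl, map_iterDeriv d hd, coeff_mapAdd, coeff_mapAdd, smul_add]

end Map

end PDO

end

end MKP
namespace MKP

noncomputable section

open PDO

/-! ### Adler map, residues and variations of a product of first-order factors. -/

section Factorization

variable {A : Type*} [CommRing A] [Differential A]

/-- `𝒫₂` at `∂⁻¹ M`, the antiderivative being replaced by any `σ`, in terms of the Adler map
of `M`. -/
theorem P2_factorized (M X : PDO A) (σ : A) :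
    (D (-1) * M * X).nonneg * (D (-1) * M) - D (-1) * M * (X * (D (-1) * M)).nonneg
      - comm (ofFun ((D (-1) * M * X).coeff 0)) (D (-1) * M)
      + D (-1) * ofFun σ′ * (D (-1) * M) + comm (D (-1) * M) (ofFun σ) =
    D (-1) * ((M * (X * D (-1))).nonneg * M - M * ((X * D (-1)) * M).nonneg
      + comm M (ofFun ((D (-1) * M * X).coeff 0 + σ))) := by
  have hE : D (-1) * M * X = D (-1) * (M * (X * D (-1))) * D 1 := by
    simp only [mul_assoc, D_neg_one_mul_D_one, mul_one]
  have h1 := D_one_mul_nonneg (M * (X * D (-1)))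
  rw [← hE] at h1
  set e := (D (-1) * M * X).coeff 0
  set U := (D (-1) * M * X).nonneg
  -- Writing `e′ = [∂, e]`, and likewise `σ′ = [∂, σ]`, leaves an identity of noncommutative words.
  have hU : U = D (-1) * ((M * (X * D (-1))).nonneg * D 1 + (D 1 * ofFun e - ofFun e * D 1)) := by
    rw [D_one_mul_ofFun, add_sub_cancel_left, ← h1, D_neg_one_mul_D_one_mul]
  have hσ : ofFun σ′ = D 1 * ofFun σ - ofFun σ * D 1 := by
    rw [D_one_mul_ofFun, add_sub_cancel_left]
  rw [hU, hσ, ofFun_add, ← mul_assoc X]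
  simp only [PDO.comm, mul_add, add_mul, mul_sub, sub_mul, mul_assoc, D_neg_one_mul_D_one_mul,
    D_one_mul_D_neg_one_mul]
  abel

/-- `(∂ - w_{i-1}) ⋯ (∂ - w_0)`. -/
def lowerProd (w : ℕ → A) : ℕ → PDO A
  | 0 => 1
  | i + 1 => (D 1 - ofFun (w i)) * lowerProd w i

/-- The product `(∂ - w_{N-1}) ⋯ (∂ - w_{N-j})` of `j` factors. -/
def topProd (w : ℕ → A) (N : ℕ) : ℕ → PDO A
  | 0 => 1
  | j + 1 => topProd w N j * (D 1 - ofFun (w (N - 1 - j)))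

/-- `(∂ - w_{N-1}) ⋯ (∂ - w_i)`. -/
def upperProd (w : ℕ → A) (N i : ℕ) : PDO A := topProd w N (N - i)

theorem lowerProd_succ (w : ℕ → A) (i : ℕ) :
    lowerProd w (i + 1) = (D 1 - ofFun (w i)) * lowerProd w i := rfl

theorem upperProd_self (w : ℕ → A) (N : ℕ) : upperProd w N N = 1 := by
  rw [upperProd, Nat.sub_self, topProd]

theorem upperProd_of_lt (w : ℕ → A) {N i : ℕ} (h : i < N) :
    upperProd w N i = upperProd w N (i + 1) * (D 1 - ofFun (w i)) := by
  obtain ⟨k, rfl⟩ := Nat.exists_eq_add_of_lt h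
  rw [upperProd, show i + k + 1 - i = k + 1 by omega, topProd, upperProd,
    show i + k + 1 - (i + 1) = k by omega, show i + k + 1 - 1 - k = i by omega]

theorem upperProd_mul_lowerProd (w : ℕ → A) {N i : ℕ} (h : i ≤ N) :
    upperProd w N i * lowerProd w i = lowerProd w N := by
  obtain ⟨k, rfl⟩ := Nat.exists_eq_add_of_le h
  induction k generalizing i with
  | zero => rw [add_zero, upperProd_self, one_mul]
  | succ k ih =>
    rw [upperProd_of_lt w (by omega), mul_assoc, ← lowerProd_succ]
    have := ih (i := i + 1) (by omega)
    rwa [show i + 1 + k = i + (k + 1) by omega] at this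

theorem upperProd_zero (w : ℕ → A) (N : ℕ) : upperProd w N 0 = lowerProd w N := by
  simpa [lowerProd] using upperProd_mul_lowerProd w N.zero_le

theorem isDiff_lowerProd (w : ℕ → A) (i : ℕ) : (lowerProd w i).IsDiff := by
  induction i with
  | zero => exact isDiff_monomial le_rfl 1
  | succ i ih => exact (isDiff_firstOrder (w i)).mul ih

theorem ordLE_lowerProd (w : ℕ → A) (i : ℕ) : (lowerProd w i).OrdLE i := by
  induction i with
  | zero => exact ordLE_ofFun 1
  | succ i ih => exact ((ordLE_firstOrder (w i)).mul ih).mono (by push_cast; omega)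

theorem coeff_lowerProd (w : ℕ → A) (i : ℕ) : (lowerProd w i).coeff i = 1 := by
  induction i with
  | zero => exact (coeff_ofFun 1 0).trans (if_pos rfl)
  | succ i ih =>
    rw [lowerProd_succ, Nat.cast_succ, add_comm (i : ℤ),
      coeff_mul_top (ordLE_firstOrder (w i)) (ordLE_lowerProd w i), coeff_one_firstOrder, ih,
      one_mul]

/-- For a gradient `Q` with respect to `M = (∂ - w_{N-1}) ⋯ (∂ - w_0)`, the derivative in the
direction of `w_i`. -/
def gradW (w : ℕ → A) (N : ℕ) (Q : PDO A) (i : ℕ) : A :=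
  -(lowerProd w i * Q * upperProd w N (i + 1)).res

/-- Telescoping of `U_i (ℓ_i Q U_i)_{≥0} ℓ_i`: its two ends are the two terms on the left, and each
increment is the Adler map of one factor, flanked by `U_{i+1}` and `ℓ_i`. -/
theorem adler_lowerProd (w : ℕ → A) (N : ℕ) (Q : PDO A) :
    (lowerProd w N * Q).nonneg * lowerProd w N - lowerProd w N * (Q * lowerProd w N).nonneg =
      ∑ i ∈ Finset.range N, upperProd w N (i + 1) * ofFun (gradW w N Q i)′ * lowerProd w i := by
  have h := Finset.sum_range_sub (fun i => upperProd w N i *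
    (lowerProd w i * Q * upperProd w N i).nonneg * lowerProd w i) N
  rw [upperProd_self, upperProd_zero] at h
  simp only [lowerProd, mul_one, one_mul] at h
  rw [← h]
  refine Finset.sum_congr rfl fun i hi => ?_
  have hn := nonneg_mul_firstOrder_sub (w i) (lowerProd w i * Q * upperProd w N (i + 1))
  rw [upperProd_of_lt w (Finset.mem_range.mp hi), gradW, map_neg, ofFun_neg, ← hn]
  simp only [mul_assoc, mul_sub, sub_mul]

theorem res_comm_lowerProd (w : ℕ → A) (N : ℕ) (Q : PDO A) :
    (lowerProd w N * Q).res - (Q * lowerProd w N).res =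
      -∑ i ∈ Finset.range N, (gradW w N Q i)′ := by
  have h := Finset.sum_range_sub
    (fun i => (lowerProd w i * Q * upperProd w N i).res) N
  rw [upperProd_self, upperProd_zero] at h
  simp only [lowerProd, mul_one, one_mul] at h
  rw [← h, ← Finset.sum_neg_distrib]
  refine Finset.sum_congr rfl fun i hi => ?_
  have hn := res_firstOrder_mul_sub (w i) (lowerProd w i * Q * upperProd w N (i + 1))
  rw [upperProd_of_lt w (Finset.mem_range.mp hi), gradW, map_neg, neg_neg, ← hn]
  simp only [mul_assoc]

/-- Cyclicity of the residue moves `ℓ_i` to the front. The sum is the form taken both by the Adler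
map and by a variation of `M`. -/
theorem map_res_mul_sum {B : Type*} [AddCommGroup B] {f : A →+ B} (hf : ∀ a : A, f a′ = 0)
    (w : ℕ → A) (N : ℕ) (Q : PDO A) (a : ℕ → A) :
    f (Q * ∑ i ∈ Finset.range N, upperProd w N (i + 1) * ofFun (a i) * lowerProd w i).res =
      -f (∑ i ∈ Finset.range N, gradW w N Q i * a i) := by
  rw [Finset.mul_sum, res_sum, map_sum, map_sum, ← Finset.sum_neg_distrib]
  refine Finset.sum_congr rfl fun i _ => ?_
  rw [← mul_assoc, map_res_mul_comm hf, gradW, neg_mul, map_neg, neg_neg, ← res_mul_ofFun]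
  simp only [mul_assoc]

/-- The second bracket at `∂⁻¹ (∂ - w_{N-1}) ⋯ (∂ - w_0)`. -/
theorem map_res_mul_P2 {B : Type*} [AddCommGroup B] {f : A →+ B} (hf : ∀ a : A, f a′ = 0)
    (w : ℕ → A) (N : ℕ) {L : PDO A} (hL : L = D (-1) * lowerProd w N) (Y X : PDO A) {σ : A}
    (hσ : σ′ = (comm L X).res) :
    f (Y * ((L * X).nonneg * L - L * (X * L).nonneg - comm (ofFun ((L * X).coeff 0)) L
      + D (-1) * ofFun (comm L X).res * L + comm L (ofFun σ))).res =
    f (∑ i ∈ Finset.range N, gradW w N (Y * D (-1)) i *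
      (-(gradW w N (X * D (-1)) i)′ +
        ∑ j ∈ Finset.range N, (gradW w N (X * D (-1)) j)′)) := by
  set M := lowerProd w N with hM
  -- The derivative of `(LX)_0` cancels the discrepancy between `res(LX)` and `res(MQ)`, leaving
  -- `res[M, Q]`.
  have hs : ((L * X).coeff 0 + σ)′ = -∑ j ∈ Finset.range N, (gradW w N (X * D (-1)) j)′ := by
    have hE : L * X = D (-1) * (M * (X * D (-1))) * D 1 := by
      simp only [hL, mul_assoc, D_neg_one_mul_D_one, mul_one]
    have h1 := res_D_neg_one_mul_mul_D_one (M * (X * D (-1)))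
    rw [← hE] at h1
    rw [map_add, hσ, PDO.comm, res_sub, h1, ← res_comm_lowerProd, hL]
    simp only [mul_assoc]
    ring
  set s := (L * X).coeff 0 + σ with hs'
  set S := ∑ j ∈ Finset.range N, (gradW w N (X * D (-1)) j)′ with hS
  rw [← hσ]
  have hP := P2_factorized M X σ
  rw [← hL, ← hs', adler_lowerProd] at hP
  rw [hP, ← mul_assoc, mul_add, res_add, map_add, map_res_mul_sum hf]
  have hc : f (Y * D (-1) * comm M (ofFun s)).res =
      f (∑ i ∈ Finset.range N, gradW w N (Y * D (-1)) i * S) := by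
    have h1 : f (Y * D (-1) * (ofFun s * M)).res = f (M * (Y * D (-1)) * ofFun s).res := by
      rw [← mul_assoc, map_res_mul_comm hf, ← mul_assoc]
    rw [PDO.comm, mul_sub, res_sub, map_sub, h1, ← map_sub, ← mul_assoc, res_mul_ofFun, res_mul_ofFun,
      ← sub_mul, ← neg_sub, res_comm_lowerProd, neg_neg, ← map_sum, ← neg_neg (f _),
      ← map_mul_deriv hf, hs, mul_neg, map_neg, neg_neg, Finset.sum_mul]
  rw [hc, ← map_neg, ← map_add, ← Finset.sum_neg_distrib, ← Finset.sum_add_distrib]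
  congr 1
  refine Finset.sum_congr rfl fun i _ => ?_
  ring

/-- The Leibniz rule on the product: `d` kills `∂`, so the factor `∂ - w_i` varies by `-d w_i`. -/
theorem mapAdd_lowerProd (d : A →+ A) (hd : ∀ a : A, d a′ = (d a)′)
    (hl : ∀ a b : A, d (a * b) = d a * b + a * d b) (w : ℕ → A) (N : ℕ) :
    mapAdd d (lowerProd w N) = ∑ i ∈ Finset.range N,
      upperProd w N (i + 1) * ofFun (-d (w i)) * lowerProd w i := by
  have hD : ∀ i : ℤ, mapAdd d (D i) = 0 := mapAdd_D (by simpa using hl 1 1)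
  have key : ∀ k ≤ N, upperProd w N k * mapAdd d (lowerProd w k) = ∑ i ∈ Finset.range k,
      upperProd w N (i + 1) * ofFun (-d (w i)) * lowerProd w i := by
    intro k hk
    induction k with
    | zero =>
      rw [lowerProd, one_eq_D, hD]
      simp
    | succ k ih =>
      rw [Finset.sum_range_succ, ← ih (by omega), lowerProd_succ, mapAdd_mul d hd hl,
        upperProd_of_lt w (show k < N by omega), map_sub, hD, ofFun, mapAdd_monomial, zero_sub,
        ofFun_neg]
      simp only [mul_add, mul_assoc]
      exact add_comm _ _
  simpa [upperProd_self] using key N le_rfl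

end Factorization

/-! ### Operators of Lax shape and their coefficients. -/

section LaxCoefficients

variable {A : Type*} [CommRing A] [Differential A] {n : ℕ}

/-- The operator `∂^n + u_n ∂^{n-1} + ⋯ + u_1 + ∂^{-1} u_0`. -/
def laxOf (u : Fin (n + 1) → A) : PDO A :=
  D n + ∑ i : Fin n, ofFun (u i.succ) * D (i : ℤ) + D (-1) * ofFun (u 0)

theorem ordLE_D_neg_one_mul_ofFun (a : A) : (D (-1) * ofFun a).OrdLE (-1) :=
  (ordLE_D (-1)).mul (ordLE_ofFun a)

theorem res_D_neg_one_mul_ofFun (a : A) : (D (-1) * ofFun a).res = a :=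
  (res_mul_ofFun _ _).trans (by rw [PDO.res, coeff_D, if_pos rfl, one_mul])

theorem coeff_laxOf_of_nonneg (u : Fin (n + 1) → A) {m : ℤ} (hm : 0 ≤ m) :
    (laxOf u).coeff m = (if m = n then 1 else 0) +
      ∑ i : Fin n, if m = (i : ℕ) then u i.succ else 0 := by
  rw [laxOf, coeff_add, coeff_add, ordLE_D_neg_one_mul_ofFun _ m (by omega), add_zero, coeff_D,
    coeff_sum]
  simp only [ofFun_mul_D, coeff_monomial]

theorem coeff_laxOf (u : Fin (n + 1) → A) (i : Fin n) : (laxOf u).coeff (i : ℕ) = u i.succ := by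
  rw [coeff_laxOf_of_nonneg u (by omega), if_neg (by omega), zero_add, Finset.sum_eq_single i]
  · simp
  · intro j _ hj
    rw [if_neg]
    simpa [Fin.ext_iff, eq_comm] using hj
  · simp

theorem res_laxOf (u : Fin (n + 1) → A) : (laxOf u).res = u 0 := by
  have h : (D n + ∑ i : Fin n, ofFun (u i.succ) * D (i : ℤ)).IsDiff := by
    refine (isDiff_monomial (by omega) 1).add fun m hm => ?_
    rw [coeff_sum]
    refine Finset.sum_eq_zero fun i _ => ?_
    rw [ofFun_mul_D]
    exact isDiff_monomial (by omega) _ m hm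
  rw [laxOf, res_add, h.res_eq_zero, zero_add, res_D_neg_one_mul_ofFun]

theorem laxOf_injective : Function.Injective (laxOf : (Fin (n + 1) → A) → PDO A) := by
  intro u u' h
  funext j
  refine Fin.cases ?_ (fun i => ?_) j
  · rw [← res_laxOf u, h, res_laxOf]
  · rw [← coeff_laxOf u, h, coeff_laxOf]

/-- Existence of the Miura map rests on this: the negative part of `∂⁻¹M` is the single term `∂⁻¹
res(∂⁻¹M)`. -/
theorem exists_laxOf_eq {M : PDO A} (hM : M.IsDiff) (ho : M.OrdLE (n + 1))
    (h1 : M.coeff (n + 1) = 1) : ∃ u : Fin (n + 1) → A, laxOf u = D (-1) * M := by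
  refine ⟨Fin.cons (D (-1) * M).res fun i => (D (-1) * M).coeff (i : ℕ), ?_⟩
  have hZ := (ordLE_D (-1)).mul ho
  have ht := coeff_mul_top (ordLE_D (-1)) ho
  have hn : (-1 : ℤ) + (n + 1) = n := by ring
  rw [hn] at hZ ht
  rw [coeff_D, if_pos rfl, h1, one_mul] at ht
  have hneg := hM.sub_nonneg_D_neg_one_mul
  rw [sub_eq_iff_eq_add] at hneg
  set Z := D (-1) * M
  ext m
  rcases lt_or_ge m 0 with hm | hm
  · have h2 := congrArg (PDO.coeff · m) hneg
    simp only [coeff_add, coeff_nonneg, if_neg (show ¬ 0 ≤ m by omega), add_zero] at h2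
    rw [h2, laxOf, coeff_add, coeff_add, coeff_D, if_neg (by omega), coeff_sum,
      Finset.sum_eq_zero]
    · simp
    · intro i _
      rw [ofFun_mul_D, coeff_monomial, if_neg (by omega)]
  · rcases lt_trichotomy m n with h | rfl | h
    · lift m to ℕ using hm
      exact coeff_laxOf _ (⟨m, by omega⟩ : Fin n)
    · rw [coeff_laxOf_of_nonneg _ hm, if_pos rfl, ht, Finset.sum_eq_zero, add_zero]
      intro i _
      rw [if_neg (by omega)]
    · rw [coeff_laxOf_of_nonneg _ hm, if_neg h.ne', hZ m h, Finset.sum_eq_zero, add_zero]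
      intro i _
      rw [if_neg (by omega)]

theorem map_laxOf {B : Type*} [CommRing B] [Differential B] (φ : A →+* B)
    (hφ : ∀ a : A, φ a′ = (φ a)′) (u : Fin (n + 1) → A) :
    (laxOf u).map φ = laxOf fun j => φ (u j) := by
  have hm : ∀ (i : ℤ) (a : A), mapHom φ hφ (monomial i a) = monomial i (φ a) :=
    fun i a => mapAdd_monomial φ.toAddMonoidHom i a
  rw [← mapHom_apply φ hφ, laxOf, laxOf]
  simp only [map_add, map_sum, map_mul, D, ofFun, hm, map_one]

/-- The pairing of a gradient with a variation of the Lax operator. -/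
theorem map_res_mul_variation {B : Type*} [AddCommGroup B] {f : A →+ B}
    (hf : ∀ a : A, f a′ = 0) (x u : Fin (n + 1) → A) :
    f ((∑ j : Fin (n + 1), D (-(j : ℤ)) * ofFun (x j)) *
      (∑ i : Fin n, ofFun (u i.succ) * D (i : ℤ) + D (-1) * ofFun (u 0))).res =
    f (∑ j, x j * u j) := by
  rw [Finset.sum_mul, res_sum, map_sum, map_sum]
  refine Finset.sum_congr rfl fun j _ => ?_
  rw [mul_assoc, map_res_mul_comm hf, mul_assoc, res_ofFun_mul]
  congr 2
  rw [PDO.res, coeff_mul_D, coeff_add, coeff_sum]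
  simp only [ofFun_mul_D, coeff_monomial]
  refine Fin.cases ?_ (fun i => ?_) j
  · have := res_D_neg_one_mul_ofFun (u 0)
    rw [PDO.res] at this
    rw [Finset.sum_eq_zero fun i _ => if_neg (by simp)]
    simpa using this
  · rw [ordLE_D_neg_one_mul_ofFun _ _ (by simp; omega), add_zero, Finset.sum_eq_single i]
    · simp
    · intro k _ hk
      rw [if_neg]
      simpa [Fin.ext_iff, eq_comm] using hk
    · simp

end LaxCoefficients

end

end MKP
namespace MKP

noncomputable section

open PDO MvPolynomial

/-! ### First variation and homomorphisms of differential algebras. -/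

section Variation

variable {K : Type*} [Field K]

theorem deriv_eq_totalDeriv {ι : Type*} (a : DiffPoly K ι) : a′ = totalDeriv K ι a := rfl

theorem integral_eq_zero_iff {ι : Type*} (f : DiffPoly K ι) :
    integral f = 0 ↔ ∃ h, totalDeriv K ι h = f :=
  Submodule.Quotient.mk_eq_zero _

theorem integral_deriv {ι : Type*} (a : DiffPoly K ι) :
    (integral : DiffPoly K ι →ₗ[K] _).toAddMonoidHom a′ = 0 :=
  (integral_eq_zero_iff _).mpr ⟨a, rfl⟩

variable {ι κ : Type*}

/-- An evolutionary variation `d` along `φ` is determined by its values on the fields. -/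
theorem variation_eq_finsum (φ : DiffPoly K ι →ₐ[K] DiffPoly K κ)
    (d : DiffPoly K ι →ₗ[K] DiffPoly K κ) (hl : ∀ f g, d (f * g) = d f * φ g + φ f * d g)
    (f : DiffPoly K ι) : d f = ∑ᶠ p : ι × ℕ, φ (pderiv p f) * d (X p) := by
  classical
  have hfin : ∀ f : DiffPoly K ι,
      (Function.support fun p : ι × ℕ => φ (pderiv p f) * d (X p)).Finite := by
    intro f
    refine f.vars.finite_toSet.subset fun p hp => ?_
    by_contra h
    exact hp (by simp [pderiv_eq_zero_of_notMem_vars h])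
  have h1 : d 1 = 0 := by simpa using hl 1 1
  induction f using MvPolynomial.induction_on with
  | C a =>
    rw [← mul_one (C a), ← smul_eq_C_mul, map_smul, h1]
    simp
  | add f g hf hg =>
    rw [map_add, hf, hg, ← finsum_add_distrib (hfin f) (hfin g)]
    simp only [map_add, add_mul]
  | mul_X f q hf =>
    have hs : φ f * d (X q) = ∑ᶠ p : ι × ℕ, φ f * φ ((Pi.single q 1 : ι × ℕ → DiffPoly K ι) p) * d (X p) := by
      rw [finsum_eq_single _ q]
      · simp
      · intro p hp
        simp [hp]
    have h2 : (Function.support fun p : ι × ℕ => φ (pderiv p f) * d (X p) * φ (X q)).Finite :=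
      (hfin f).subset fun p hp h => hp (by simp only [h, zero_mul])
    have h3 : (Function.support fun p : ι × ℕ =>
        φ f * φ ((Pi.single q 1 : ι × ℕ → DiffPoly K ι) p) * d (X p)).Finite := by
      refine (Set.finite_singleton q).subset fun p hp => ?_
      by_contra h
      exact hp (by simp [show p ≠ q from h])
    rw [hl, hf, hs, finsum_mul' _ _ (hfin f), ← finsum_add_distrib h2 h3]
    refine finsum_congr fun p => ?_
    rw [Derivation.leibniz, pderiv_X, smul_eq_mul, smul_eq_mul, map_add, map_mul, map_mul,
      show (Pi.single p 1 : ι × ℕ → DiffPoly K ι) q =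
          (Pi.single q 1 : ι × ℕ → DiffPoly K ι) p by
        simp only [Pi.single_apply, eq_comm]]
    ring

theorem integral_mul_iterDeriv (φ : DiffHom K ι κ) (k : ℕ) (a : DiffPoly K ι)
    (h : DiffPoly K κ) :
    integral (φ.toAlgHom a * iterDeriv k h) =
      integral (φ.toAlgHom (((-(totalDeriv K ι).toLinearMap) ^ k) a) * h) := by
  induction k generalizing a with
  | zero => simp
  | succ k ih =>
    have := map_mul_deriv integral_deriv (φ.toAlgHom a) (iterDeriv k h)
    rw [iterDeriv_succ, pow_succ, Module.End.mul_apply, ← ih]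
    refine this.trans ?_
    rw [LinearMap.neg_apply, map_neg, neg_mul, map_neg]
    refine congrArg (fun x => -integral (x * iterDeriv k h)) ?_
    exact (φ.map_totalDeriv' a).symm

/-- The first variation formula along a homomorphism of differential algebras. -/
theorem integral_variation [Fintype ι] (φ : DiffHom K ι κ) (d : DiffPoly K ι →ₗ[K] DiffPoly K κ)
    (hl : ∀ f g, d (f * g) = d f * φ.toAlgHom g + φ.toAlgHom f * d g)
    (hd : ∀ f, d (totalDeriv K ι f) = totalDeriv K κ (d f)) (f : DiffPoly K ι) :
    integral (d f) =
      integral (∑ i, φ.toAlgHom (varDeriv i (integral f)) * d (X (i, 0))) := by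
  classical
  choose N hN using fun i => exists_forall_pderiv_eq_zero i f
  set T := Finset.univ.sup N
  have hT' : ∀ i k, T ≤ k → pderiv (i, k) f = 0 := fun i k hk =>
    hN i k ((Finset.le_sup (Finset.mem_univ i)).trans hk)
  have hX : ∀ i k, d (X (i, k)) = iterDeriv k (d (X (i, 0))) := by
    intro i k
    induction k with
    | zero => rfl
    | succ k ih =>
      rw [iterDeriv_succ, ← ih, deriv_eq_totalDeriv, ← hd, totalDeriv, mkDerivation_X]
  have hv : ∀ i, varDeriv i (integral f) = ∑ k ∈ Finset.range T, eulerTerm i k f := by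
    intro i
    change ∑ᶠ k, eulerTerm i k f = _
    refine finsum_eq_finsetSum_of_support_subset _ fun k hk => ?_
    by_contra h
    refine hk ?_
    simp only [Finset.coe_range, Set.mem_Iio, not_lt] at h
    simp [eulerTerm, hT' i k h]
  rw [variation_eq_finsum φ.toAlgHom d hl f, finsum_eq_finsetSum_of_support_subset
    (s := Finset.univ ×ˢ Finset.range T), Finset.sum_product, map_sum, map_sum]
  · refine Finset.sum_congr rfl fun i _ => ?_
    rw [hv, map_sum, map_sum, Finset.sum_mul, map_sum]
    refine Finset.sum_congr rfl fun k _ => ?_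
    rw [hX, integral_mul_iterDeriv]
    rfl
  · rintro ⟨i, k⟩ hp
    by_contra h
    refine hp ?_
    simp only [Finset.coe_product, Finset.coe_univ, Finset.coe_range, Set.mem_prod, Set.mem_univ,
      Set.mem_Iio, true_and, not_lt] at h
    simp [hT' i k h]

/-- The evolutionary derivation with `u_i ↦ h_i`. -/
def evolutionary (h : ι → DiffPoly K ι) : Derivation K (DiffPoly K ι) (DiffPoly K ι) :=
  mkDerivation K fun p => iterDeriv p.2 (h p.1)

theorem evolutionary_X (h : ι → DiffPoly K ι) (i : ι) : evolutionary h (X (i, 0)) = h i :=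
  mkDerivation_X _ _ _

theorem evolutionary_totalDeriv (h : ι → DiffPoly K ι) (f : DiffPoly K ι) :
    evolutionary h (totalDeriv K ι f) = totalDeriv K ι (evolutionary h f) := by
  have hc : ⁅evolutionary h, totalDeriv K ι⁆ = 0 := by
    refine derivation_ext fun p => ?_
    rw [Derivation.commutator_apply]
    simp only [evolutionary, totalDeriv, mkDerivation_X, iterDeriv_succ]
    exact sub_self _
  have := DFunLike.congr_fun hc f
  rw [Derivation.commutator_apply] at this
  exact sub_eq_zero.mp this

/-- The homomorphism of differential algebras with `u_i ↦ a_i`. -/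
def DiffHom.ofFields (a : ι → DiffPoly K κ) : DiffHom K ι κ where
  toAlgHom := aeval fun p => iterDeriv p.2 (a p.1)
  map_totalDeriv' f := by
    induction f using MvPolynomial.induction_on with
    | C c => simp [← algebraMap_eq]
    | add f g hf hg => simp only [map_add, hf, hg]
    | mul_X f p hf =>
      simp only [Derivation.leibniz, smul_eq_mul, map_add, map_mul, hf]
      congr 2
      rw [totalDeriv, mkDerivation_X, aeval_X, aeval_X]
      exact iterDeriv_succ _ _

theorem DiffHom.ofFields_X (a : ι → DiffPoly K κ) (i : ι) :
    (DiffHom.ofFields a).toAlgHom (X (i, 0)) = a i :=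
  aeval_X _ _

theorem DiffHom.ext_fields {φ ψ : DiffHom K ι κ}
    (h : ∀ i, φ.toAlgHom (X (i, 0)) = ψ.toAlgHom (X (i, 0))) : φ = ψ := by
  have : φ.toAlgHom = ψ.toAlgHom := by
    refine MvPolynomial.algHom_ext fun ⟨i, k⟩ => ?_
    induction k with
    | zero => exact h i
    | succ k ih =>
      have hX : (X (i, k + 1) : DiffPoly K ι) = totalDeriv K ι (X (i, k)) := by
        rw [totalDeriv, mkDerivation_X]
      rw [hX, φ.map_totalDeriv', ψ.map_totalDeriv', ih]
  cases φ
  cases ψ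
  congr

/-- The identity. -/
def DiffHom.id (K ι : Type*) [Field K] : DiffHom K ι ι := ⟨AlgHom.id K _, fun _ => rfl⟩

end Variation

/-! ### The Miura map and the transformation of the bracket. -/

section Miura

variable {K : Type*} [Field K] {n : ℕ}

/-- The fields `w_i`, extended by `0`. -/
def wExt (K : Type*) [Field K] (n : ℕ) (i : ℕ) : DiffPoly K (Fin (n + 1)) :=
  if h : i < n + 1 then w K n ⟨i, h⟩ else 0

theorem wExt_val (i : Fin (n + 1)) : wExt K n i = w K n i := dif_pos i.2

theorem lowerProd_eq_prod {A : Type*} [CommRing A] [Differential A] (w : ℕ → A) (N : ℕ) :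
    lowerProd w N = (List.ofFn fun i : Fin N => D 1 - ofFun (w (i.rev : Fin N))).prod := by
  induction N with
  | zero => simp [lowerProd]
  | succ N ih =>
    rw [List.ofFn_succ, List.prod_cons, lowerProd_succ, ih]
    simp [Fin.rev_succ]

theorem factorizedLax_eq : factorizedLax K n = D (-1) * lowerProd (wExt K n) (n + 1) := by
  rw [lowerProd_eq_prod, factorizedLax]
  simp only [wExt_val]

theorem lax_eq : lax K n = laxOf (v K n) := rfl

theorem DiffHom.map_deriv {ι κ : Type*} (φ : DiffHom K ι κ) (a : DiffPoly K ι) :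
    (φ.toAlgHom : DiffPoly K ι →+* DiffPoly K κ) a′ =
      ((φ.toAlgHom : DiffPoly K ι →+* DiffPoly K κ) a)′ :=
  φ.map_totalDeriv' a

theorem isMiura_iff (φ : DiffHom K (Fin (n + 1)) (Fin (n + 1))) :
    IsMiura φ ↔ laxOf (fun j => φ.toAlgHom (v K n j)) =
      D (-1) * lowerProd (wExt K n) (n + 1) := by
  rw [IsMiura, lax_eq, map_laxOf _ φ.map_deriv, factorizedLax_eq]
  rfl

theorem existsUnique_isMiura :
    ∃! φ : DiffHom K (Fin (n + 1)) (Fin (n + 1)), IsMiura φ := by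
  have ho := ordLE_lowerProd (wExt K n) (n + 1)
  have h1 := coeff_lowerProd (wExt K n) (n + 1)
  rw [Nat.cast_succ] at ho h1
  obtain ⟨u, hu⟩ := exists_laxOf_eq (isDiff_lowerProd (wExt K n) (n + 1)) ho h1
  refine ⟨DiffHom.ofFields u, ?_, fun ψ (hψ : IsMiura ψ) => ?_⟩
  · change IsMiura _
    rw [isMiura_iff, ← hu]
    congr 1
    funext j
    exact DiffHom.ofFields_X u j
  · rw [isMiura_iff, ← hu] at hψ
    refine DiffHom.ext_fields fun j => ?_
    rw [DiffHom.ofFields_X]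
    exact congrFun (laxOf_injective hψ) j

theorem exists_deriv_eq_res_comm {ι : Type*} (P Q : PDO (DiffPoly K ι)) :
    ∃ h, totalDeriv K ι h = (PDO.comm P Q).res := by
  rw [← integral_eq_zero_iff, PDO.comm, res_sub, map_sub, sub_eq_zero]
  exact map_res_mul_comm integral_deriv P Q

/-- The gradient with respect to the fields `w_i`, tested against a variation. -/
theorem integral_sum_varDeriv {φ : DiffHom K (Fin (n + 1)) (Fin (n + 1))} (hφ : IsMiura φ)
    (F : Functional K (Fin (n + 1))) (h : Fin (n + 1) → DiffPoly K (Fin (n + 1))) :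
    integral (∑ i, varDeriv i (φ.onFunctional F) * h i) =
      integral (∑ i : Fin (n + 1), gradW (wExt K n) (n + 1)
        ((grad F).map (φ.toAlgHom : _ →+* DiffPoly K (Fin (n + 1))) * D (-1)) i * h i) := by
  obtain ⟨f, rfl⟩ := Submodule.mkQ_surjective _ F
  change integral (∑ i, varDeriv i (integral (φ.toAlgHom f)) * h i) = _
  -- The same variation of `φ f` is computed twice: in the fields `w`, and through the fields `v`
  -- along `φ`.
  have e1 := integral_variation (DiffHom.id K _) (evolutionary h).toLinearMap
    (fun f g => by simp [DiffHom.id]; ring) (evolutionary_totalDeriv h) (φ.toAlgHom f)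
  have e2 := integral_variation φ ((evolutionary h).toLinearMap ∘ₗ φ.toAlgHom.toLinearMap)
    (fun f g => by simp; ring)
    (fun f => by
      simp only [LinearMap.comp_apply, AlgHom.toLinearMap_apply, φ.map_totalDeriv']
      exact evolutionary_totalDeriv h _) f
  simp only [Derivation.coeFn_coe, evolutionary_X] at e1
  refine e1.symm.trans (e2.trans ?_)
  set d : DiffPoly K (Fin (n + 1)) →+ DiffPoly K (Fin (n + 1)) :=
    (evolutionary h).toLinearMap.toAddMonoidHom
  have hd1 : ∀ a, d a′ = (d a)′ := evolutionary_totalDeriv h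
  have hd2 : ∀ a b, d (a * b) = d a * b + a * d b := fun a b => by
    refine ((evolutionary h).leibniz a b).trans ?_
    rw [smul_eq_mul, smul_eq_mul, mul_comm b]
    exact add_comm _ _
  have hD : ∀ i : ℤ, mapAdd d (D i) = 0 := mapAdd_D (by simpa using hd2 1 1)
  -- Varying both sides of the factorization relates `δv` to `δw = h`.
  have hL := congrArg (mapAdd d) ((isMiura_iff φ).mp hφ)
  rw [mapAdd_mul d hd1 hd2, hD, zero_mul, zero_add, mapAdd_lowerProd d hd1 hd2, laxOf, map_add,
    map_add, hD, zero_add, map_sum, mapAdd_mul d hd1 hd2, hD, zero_mul, zero_add, ofFun,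
    mapAdd_monomial] at hL
  simp only [ofFun_mul_D, mapAdd_monomial] at hL
  have hX : (grad (integral f)).map (φ.toAlgHom : _ →+* DiffPoly K (Fin (n + 1))) =
      ∑ j : Fin (n + 1), D (-(j : ℤ)) * ofFun (φ.toAlgHom (varDeriv j (integral f))) := by
    have hm : ∀ (i : ℤ) a, mapHom _ φ.map_deriv (monomial i a) = monomial i (φ.toAlgHom a) :=
      fun i a => mapAdd_monomial _ i a
    rw [← mapHom_apply _ φ.map_deriv, grad]
    simp only [map_sum, map_mul, D, ofFun, hm, map_one]
  have e3 := map_res_mul_variation integral_deriv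
    (fun j => φ.toAlgHom (varDeriv j (integral f))) (fun j => d (φ.toAlgHom (v K n j)))
  simp only [ofFun_mul_D] at e3
  rw [← hX] at e3
  refine e3.symm.trans ?_
  rw [ofFun, hL, ← mul_assoc, map_res_mul_sum integral_deriv, ← map_neg, ← Finset.sum_neg_distrib,
    Finset.sum_range]
  refine congrArg integral (Finset.sum_congr rfl fun i _ => ?_)
  rw [mul_neg, neg_neg, wExt_val]
  exact congrArg _ (evolutionary_X h i)

/-- The sum of the two integrands is the derivative of `-∑ a_i b_i + (∑ a_i)(∑ b_j)`. -/
theorem integral_sum_mul_skew (a b : Fin (n + 1) → DiffPoly K (Fin (n + 1))) :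
    integral (∑ i, a i * (-(b i)′ + ∑ j, (b j)′)) =
      -integral (∑ i, b i * (-(a i)′ + ∑ j, (a j)′)) := by
  rw [← map_neg, ← sub_eq_zero, ← map_sub, integral_eq_zero_iff]
  refine ⟨-∑ i, a i * b i + (∑ i, a i) * ∑ j, b j, ?_⟩
  simp only [deriv_eq_totalDeriv, mul_add, Finset.sum_add_distrib, ← Finset.sum_mul, map_add,
    map_neg, map_sum, Derivation.leibniz, smul_eq_mul, mul_neg, Finset.sum_neg_distrib]
  ring

theorem bracketW_eq (F G : Functional K (Fin (n + 1))) :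
    bracketW F G = integral (∑ i, varDeriv i F *
      (-(varDeriv i G)′ + ∑ j, (varDeriv j G)′)) := by
  rw [bracketW, ← map_neg, ← map_add, Finset.sum_mul, ← Finset.sum_neg_distrib,
    ← Finset.sum_add_distrib]
  refine congrArg integral (Finset.sum_congr rfl fun i _ => ?_)
  ring

theorem deriv_antideriv {A : Type*} [CommRing A] [Differential A] {a : A} (h : ∃ b : A, b′ = a) :
    (antideriv a)′ = a := by
  rw [antideriv, dif_pos h]
  exact h.choose_spec

theorem onFunctional_bracketP2 {φ : DiffHom K (Fin (n + 1)) (Fin (n + 1))} (hφ : IsMiura φ)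
    (F G : Functional K (Fin (n + 1))) :
    φ.onFunctional (bracketP2 F G) = bracketW (φ.onFunctional F) (φ.onFunctional G) := by
  let ψ : DiffPoly K (Fin (n + 1)) →+* DiffPoly K (Fin (n + 1)) := φ.toAlgHom
  let Φ := mapHom ψ φ.map_deriv
  set a : ℕ → DiffPoly K (Fin (n + 1)) :=
    gradW (wExt K n) (n + 1) ((grad F).map ψ * D (-1))
  set b : ℕ → DiffPoly K (Fin (n + 1)) :=
    gradW (wExt K n) (n + 1) ((grad G).map ψ * D (-1))
  have hright : bracketW (φ.onFunctional F) (φ.onFunctional G) =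
      integral (∑ i : Fin (n + 1), a i * (-(b i)′ + ∑ j : Fin (n + 1), (b j)′)) := by
    -- The gradient of `F` is replaced first; skew-symmetry then brings that of `G` into the
    -- undifferentiated slot.
    rw [bracketW_eq, integral_sum_varDeriv hφ, integral_sum_mul_skew,
      integral_sum_varDeriv hφ G, ← integral_sum_mul_skew]
  have hσ : (antideriv (PDO.comm (lax K n) (grad G)).res)′ = (PDO.comm (lax K n) (grad G)).res :=
    deriv_antideriv (exists_deriv_eq_res_comm (lax K n) (grad G))
  have hofFun : ∀ x, Φ (ofFun x) = ofFun (ψ x) := fun x => mapAdd_monomial ψ.toAddMonoidHom 0 x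
  have hD : ∀ i, Φ (D i) = D i := fun i =>
    (mapAdd_monomial ψ.toAddMonoidHom i 1).trans (congrArg (monomial i) (map_one ψ))
  have hnn : ∀ P, Φ P.nonneg = (Φ P).nonneg := fun P => by
    refine PDO.ext fun m => ?_
    change ψ (P.nonneg.coeff m) = _
    rw [coeff_nonneg, coeff_nonneg]
    split_ifs
    · rfl
    · exact map_zero ψ
  have hcoeff : ∀ (P : PDO _) m, ψ (P.coeff m) = (Φ P).coeff m := fun _ _ => rfl
  have hres : ∀ P : PDO _, ψ P.res = (Φ P).res := fun _ => rfl
  have hcomm : ∀ P Q : PDO _, Φ (PDO.comm P Q) = PDO.comm (Φ P) (Φ Q) := fun P Q => by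
    rw [PDO.comm, map_sub, map_mul, map_mul]
    rfl
  have hL : Φ (lax K n) = D (-1) * lowerProd (wExt K n) (n + 1) :=
    Eq.trans hφ factorizedLax_eq
  -- The image of the chosen antiderivative need not be the chosen one downstairs; that it is some
  -- antiderivative suffices.
  have hσ' : (ψ (antideriv (PDO.comm (lax K n) (grad G)).res))′ =
      (PDO.comm (Φ (lax K n)) (Φ (grad G))).res := by
    rw [← hcomm, ← hres]
    exact (φ.map_deriv _).symm.trans (congrArg ψ hσ)
  have key := map_res_mul_P2 integral_deriv (wExt K n) (n + 1) hL (Φ (grad F)) (Φ (grad G)) hσ'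
  have hleft : φ.onFunctional (bracketP2 F G) = integral (ψ (grad F * P2 (lax K n) (grad G)).res) :=
    rfl
  rw [hleft, hres, hright, P2]
  simp only [map_add, map_sub, map_mul, hnn, hcomm, hofFun, hcoeff, hD, hres]
  refine key.trans ?_
  rw [Finset.sum_range, Finset.sum_range]
  rfl

end Miura

end

end MKP

theorem theorem1 (K : Type*) [Field K] [CharZero K] (n : ℕ) :
    -- The factorization determines the Miura substitution `v ↦ v(w)`.
    (∃! φ : MKP.DiffHom K (Fin (n + 1)) (Fin (n + 1)), MKP.IsMiura φ) ∧
    -- The antiderivative in `𝒫₂` exists on every gradient.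
    (∀ G : MKP.Functional K (Fin (n + 1)), ∃ h : MKP.DiffPoly K (Fin (n + 1)),
      MKP.totalDeriv K (Fin (n + 1)) h = (MKP.PDO.comm (MKP.lax K n) (MKP.grad G)).res) ∧
    -- The Miura substitution carries the second bracket to the constant bracket.
    (∀ φ : MKP.DiffHom K (Fin (n + 1)) (Fin (n + 1)), MKP.IsMiura φ →
      ∀ F G : MKP.Functional K (Fin (n + 1)),
        φ.onFunctional (MKP.bracketP2 F G)
          = MKP.bracketW (φ.onFunctional F) (φ.onFunctional G)) :=
  ⟨MKP.existsUnique_isMiura, fun G => MKP.exists_deriv_eq_res_comm _ (MKP.grad G),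
    fun _ hφ F G => MKP.onFunctional_bracketP2 hφ F G⟩
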